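/- Let $\mathbb K$ be a field of characteristic zero. Let $Lie(\mathcal{PT})$ be the free Lie algebra on the set of planar rooted trees (with labelled vertices), with the left grafting $\triangleright$: for trees $\tau_1,\tau_2$, $\tau_1\triangleright\tau_2$ is the sum over all ways of adding an edge from a vertex of $\tau_2$ to the root of $\tau_1$ that is leftmost at this vertex, and $\triangleright$ is extended bilinearly by $$x\triangleright[y,z]=[x\triangleright y,z]+[y,x\triangleright z],\qquad [x,y]\triangleright z=x\triangleright(y\triangleright z)-(x\triangleright y)\triangleright z-y\triangleright(x\triangleright z)+(y\triangleright x)\triangleright z .$$ Let $Lie(\mathcal{PT})_n$ be the space spanned by the Lie brackets over planar trees that have exactly $n$ vertices in total, labelled bijectively by $\{1,\dots,n\}$; the symmetric group $\Sigma_n$ acts by permuting labels. Let $\bullet_i$ be the single-vertex tree labelled $i$. Every $\omega\in Lie(\mathcal{PT})_n$ is a linear combination of post-Lie monomials (formal expressions built with $[\cdot,\cdot]$ and $\triangleright$) in $\bullet_1,\dots,\bullet_n$, each containing every $\bullet_i$ exactly once. For $\omega_i\in Lie(\mathcal{PT})_{k_i}$ let $\omega_1\cdots\omega_n\circ\omega\in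 Lie(\mathcal{PT})_{k_1+\dots+k_n}$ be the result of replacing $\bullet_i$ by $\omega_i$, for all $i$, in an expression of $\omega$ as a linear combination of post-Lie monomials in $\bullet_1,\dots,\bullet_n$, where the labels $1,\dots,k_i$ of $\omega_i$ are shifted by $k_1+\dots+k_{i-1}$. Then the following hold. 1. The composition $\circ$ is well defined (it does not depend on the chosen expression of $\omega$), and with it, the actions of the groups $\Sigma_n$ and the identity element $\bullet_1\in Lie(\mathcal{PT})_1$, the sequence $\widehat{Lie(\mathcal{PT})}=(Lie(\mathcal{PT})_n)_{n\ge1}$ is a symmetric operad. 2. If $\omega,\omega_1,\dots,\omega_n$ are Lie monomials (iterated brackets) of labelled planar trees, then $\omega_1\cdots\omega_n\circ\omega$ is the signed sum of all Lie brackets of planar trees obtained by replacing each vertex $i$ of $\omega$ by $\omega_i$ as follows. Each edge going out of vertex $i$ of $\omega$ becomes outgoing from an arbitrary vertex of $\omega_i$, to the left of all edges of $\omega_i$ going out of that vertex; edges of $\omega$ which go out of $i$ and end up at the same vertex of $\omega_i$ keep their left-to-right order. The edge coming into a vertex $j$ of $\omega$ becomes an edge coming into the root of $\omega_j$ if $\omega_j$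 is a tree. If $\omega_j$ is a bracket, it becomes one edge for each root of $\omega_j$, and all trees of $\omega_j$ are grafted to the same vertex, next to each other, in all the left-to-right orders and with the signs prescribed by expanding the bracket through $[a,b]=ab-ba$. 3. This operad is the post-Lie operad, whose $n$-ary operations are the multilinear elements of the free post-Lie algebra on $n$ generators, with substitution as composition: there is an isomorphism of operads from the post-Lie operad to $\widehat{Lie(\mathcal{PT})}$ that sends the class of every multilinear combination of post-Lie monomials in the generators $x_1,\dots,x_n$ to its value at $x_i=\bullet_i$. -/

import Mathlib

open scoped TensorProduct

noncomputable section

/-! ### Symmetric operads -/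

/-- Transport along an equality of arities. -/
def arityCast {P : ℕ → Type*} {a b : ℕ} (h : a = b) (x : P a) : P b := h ▸ x

/-- The permutation of `{1, …, k 1 + ⋯ + k n}` which permutes the blocks of sizes `k 1, …, k n`:
the `l`-th element of block `i` goes to the `l`-th element of the block in position `σ i`. -/
def blockPerm {n : ℕ} (σ : Equiv.Perm (Fin n)) (k : Fin n → ℕ) :
    Equiv.Perm (Fin (∑ i, k i)) :=
  ((finSigmaFinEquiv (n := k)).symm.trans
    ((Equiv.sigmaCongrLeft (β := fun i => Fin (k i)) σ⁻¹).symm.trans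
      (finSigmaFinEquiv (n := fun i => k (σ⁻¹ i))))).trans
    (finCongr (Equiv.sum_comp σ⁻¹ k))

/-- The permutation of `{1, …, k 1 + ⋯ + k n}` which acts by `σ i` on the `i`-th block. -/
def blockSum {n : ℕ} {k : Fin n → ℕ} (σ : ∀ i, Equiv.Perm (Fin (k i))) :
    Equiv.Perm (Fin (∑ i, k i)) :=
  (finSigmaFinEquiv (n := k)).permCongr (Equiv.sigmaCongrRight σ)

theorem sum_blocks {m : ℕ} (n : Fin m → ℕ) (k : ∀ j, Fin (n j) → ℕ) :
    ∑ j, ∑ l, k j l =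
      ∑ p : Fin (∑ j, n j), k (finSigmaFinEquiv.symm p).1 (finSigmaFinEquiv.symm p).2 := by
  rw [Equiv.sum_comp finSigmaFinEquiv.symm (fun q : (j : Fin m) × Fin (n j) => k q.1 q.2),
    Fintype.sum_sigma]

/-- A symmetric operad structure on the sequence of vector spaces `P n`: an action of each
symmetric group `Σ_n` on `P n`, an identity element, and compositions
`P (k 1) ⊗ ⋯ ⊗ P (k n) ⊗ P n → P (k 1 + ⋯ + k n)`, `x_1 ⋯ x_n ⊗ y ↦ x_1 ⋯ x_n ∘ y`. -/
structure SymOperad (K : Type*) [Field K] (P : ℕ → Type*) [∀ n, AddCommGroup (P n)]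
    [∀ n, Module K (P n)] where
  act (n : ℕ) : Equiv.Perm (Fin n) →* Module.End K (P n)
  one : P 1
  comp {n : ℕ} (k : Fin n → ℕ) : MultilinearMap K (fun i => P (k i)) (P n →ₗ[K] P (∑ i, k i))
  comp_one {n : ℕ} (x : P n) :
    arityCast (by simp) (comp (fun _ : Fin 1 => n) (fun _ => x) one) = x
  one_comp {n : ℕ} (y : P n) :
    arityCast (by simp) (comp (fun _ : Fin n => 1) (fun _ => one) y) = y
  assoc {m : ℕ} (n : Fin m → ℕ) (k : ∀ j, Fin (n j) → ℕ) (x : ∀ j l, P (k j l))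
    (y : ∀ j, P (n j)) (z : P m) :
    arityCast (sum_blocks n k)
        (comp (fun j => ∑ l, k j l) (fun j => comp (k j) (x j) (y j)) z) =
      comp (fun p => k (finSigmaFinEquiv.symm p).1 (finSigmaFinEquiv.symm p).2)
        (fun p => x (finSigmaFinEquiv.symm p).1 (finSigmaFinEquiv.symm p).2) (comp n y z)
  act_outer {n : ℕ} (σ : Equiv.Perm (Fin n)) (k : Fin n → ℕ) (x : ∀ i, P (k i)) (y : P n) :
    arityCast (Equiv.sum_comp σ⁻¹ k)
        (comp (fun i => k (σ⁻¹ i)) (fun i => x (σ⁻¹ i)) (act n σ y)) =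
      act (∑ i, k i) (blockPerm σ k) (comp k x y)
  act_inner {n : ℕ} (k : Fin n → ℕ) (σ : ∀ i, Equiv.Perm (Fin (k i))) (x : ∀ i, P (k i))
    (y : P n) :
    comp k (fun i => act (k i) (σ i) (x i)) y = act (∑ i, k i) (blockSum σ) (comp k x y)

/-- An isomorphism of symmetric operads. -/
structure SymOperad.Iso {K : Type*} [Field K] {P Q : ℕ → Type*} [∀ n, AddCommGroup (P n)]
    [∀ n, Module K (P n)] [∀ n, AddCommGroup (Q n)] [∀ n, Module K (Q n)]
    (S : SymOperad K P) (T : SymOperad K Q) where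
  equiv (n : ℕ) : P n ≃ₗ[K] Q n
  map_act (n : ℕ) (σ : Equiv.Perm (Fin n)) (x : P n) :
    equiv n (S.act n σ x) = T.act n σ (equiv n x)
  map_one : equiv 1 S.one = T.one
  map_comp {n : ℕ} (k : Fin n → ℕ) (x : ∀ i, P (k i)) (y : P n) :
    equiv (∑ i, k i) (S.comp k x y) = T.comp k (fun i => equiv (k i) (x i)) (equiv n y)

/-! ### Post-Lie monomials, the free post-Lie algebra and the post-Lie operad -/

/-- Post-Lie monomials in variables from `α`: formal expressions built from the variables with two
binary operations, a bracket `[·,·]` and a grafting `· ▷ ·`. -/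
inductive PostLieMonomial (α : Type) : Type
  | var : α → PostLieMonomial α
  | bracket : PostLieMonomial α → PostLieMonomial α → PostLieMonomial α
  | graft : PostLieMonomial α → PostLieMonomial α → PostLieMonomial α

namespace PostLieMonomial

/-- The variables which occur in a monomial, with multiplicity. -/
def labels {α : Type} : PostLieMonomial α → Multiset α
  | var a => {a}
  | bracket x y => x.labels + y.labels
  | graft x y => x.labels + y.labels

/-- The value of a monomial when the variable `a` is replaced by `v a` and the two operations are
interpreted by `br` and `gr`. -/
def eval {α : Type} {M : Type*} (br gr : M → M → M) (v : α → M) : PostLieMonomial α → M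
  | var a => v a
  | bracket x y => br (x.eval br gr v) (y.eval br gr v)
  | graft x y => gr (x.eval br gr v) (y.eval br gr v)

end PostLieMonomial

/-- Formal linear combinations of post-Lie monomials. -/
abbrev PostLiePoly (K : Type*) [Field K] (α : Type) := PostLieMonomial α →₀ K

namespace PostLiePoly

variable (K : Type*) [Field K] {α : Type}

/-- The bilinear extension of a binary operation on monomials. -/
def bilin (op : PostLieMonomial α → PostLieMonomial α → PostLieMonomial α) :
    PostLiePoly K α →ₗ[K] PostLiePoly K α →ₗ[K] PostLiePoly K α :=
  Finsupp.linearCombination K fun a => Finsupp.linearCombination K fun b =>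
    Finsupp.single (op a b) 1

theorem bilin_single (op : PostLieMonomial α → PostLieMonomial α → PostLieMonomial α)
    (a b : PostLieMonomial α) (r s : K) :
    bilin K op (Finsupp.single a r) (Finsupp.single b s) = Finsupp.single (op a b) (r * s) := by
  simp only [bilin, Finsupp.linearCombination_single, LinearMap.smul_apply, Finsupp.smul_single,
    smul_eq_mul, mul_one]

/-- The formal bracket. -/
abbrev br : PostLiePoly K α →ₗ[K] PostLiePoly K α →ₗ[K] PostLiePoly K α :=
  bilin K PostLieMonomial.bracket

/-- The formal grafting. -/
abbrev gr : PostLiePoly K α →ₗ[K] PostLiePoly K α →ₗ[K] PostLiePoly K α :=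
  bilin K PostLieMonomial.graft

/-- The relators of post-Lie algebras: the bracket is a Lie bracket, `x ▷ ·` is a derivation of it,
and `[x,y] ▷ z = x ▷ (y ▷ z) - (x ▷ y) ▷ z - y ▷ (x ▷ z) + (y ▷ x) ▷ z`; closed under both
operations with arbitrary elements on either side. -/
inductive Relator : PostLiePoly K α → Prop
  | lie_self (x : PostLiePoly K α) : Relator (br K x x)
  | jacobi (x y z : PostLiePoly K α) :
      Relator (br K x (br K y z) - br K (br K x y) z - br K y (br K x z))
  | derivation (x y z : PostLiePoly K α) :
      Relator (gr K x (br K y z) - br K (gr K x y) z - br K y (gr K x z))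
  | bracket_graft (x y z : PostLiePoly K α) :
      Relator (gr K (br K x y) z - (gr K x (gr K y z) - gr K (gr K x y) z
        - gr K y (gr K x z) + gr K (gr K y x) z))
  | br_left (x y : PostLiePoly K α) : Relator x → Relator (br K x y)
  | br_right (x y : PostLiePoly K α) : Relator y → Relator (br K x y)
  | gr_left (x y : PostLiePoly K α) : Relator x → Relator (gr K x y)
  | gr_right (x y : PostLiePoly K α) : Relator y → Relator (gr K x y)

variable (α)

/-- The ideal spanned by the relators. -/
def relations : Submodule K (PostLiePoly K α) := Submodule.span K {p | Relator K p}

end PostLiePoly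

/-- The free post-Lie algebra on the set `α`. -/
abbrev FreePostLie (K : Type*) [Field K] (α : Type) := PostLiePoly K α ⧸ PostLiePoly.relations K α

namespace FreePostLie

variable (K : Type*) [Field K] {α β γ : Type}

/-- A bilinear map on polynomials which respects the relations descends to the quotient. -/
def descend (B : PostLiePoly K α →ₗ[K] PostLiePoly K α →ₗ[K] PostLiePoly K α)
    (h₁ : ∀ x y, PostLiePoly.Relator K x → PostLiePoly.Relator K (B x y))
    (h₂ : ∀ x y, PostLiePoly.Relator K y → PostLiePoly.Relator K (B x y)) :
    FreePostLie K α →ₗ[K] FreePostLie K α →ₗ[K] FreePostLie K α :=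
  Submodule.liftQ _
    (LinearMap.flip (Submodule.liftQ _
      (LinearMap.flip (LinearMap.compr₂ B (PostLiePoly.relations K α).mkQ)) (by
        refine Submodule.span_le.2 fun y hy => LinearMap.ext fun x => ?_
        exact (Submodule.Quotient.mk_eq_zero _).2 (Submodule.subset_span (h₂ _ y hy)))))
    (by
      refine Submodule.span_le.2 fun x hx => LinearMap.ext fun q => ?_
      obtain ⟨y, rfl⟩ := Submodule.mkQ_surjective _ q
      exact (Submodule.Quotient.mk_eq_zero _).2 (Submodule.subset_span (h₁ x y hx)))

/-- The Lie bracket of the free post-Lie algebra. -/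
def br : FreePostLie K α →ₗ[K] FreePostLie K α →ₗ[K] FreePostLie K α :=
  descend K (PostLiePoly.br K) PostLiePoly.Relator.br_left PostLiePoly.Relator.br_right

/-- The grafting product of the free post-Lie algebra. -/
def gr : FreePostLie K α →ₗ[K] FreePostLie K α →ₗ[K] FreePostLie K α :=
  descend K (PostLiePoly.gr K) PostLiePoly.Relator.gr_left PostLiePoly.Relator.gr_right

/-- The class of a polynomial. -/
def mk : PostLiePoly K α →ₗ[K] FreePostLie K α := (PostLiePoly.relations K α).mkQ

/-- The class of a monomial. -/
def ofMonomial (e : PostLieMonomial α) : FreePostLie K α := mk K (Finsupp.single e 1)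

theorem br_mk (x y : PostLiePoly K α) : br K (mk K x) (mk K y) = mk K (PostLiePoly.br K x y) := rfl

theorem gr_mk (x y : PostLiePoly K α) : gr K (mk K x) (mk K y) = mk K (PostLiePoly.gr K x y) := rfl

theorem mk_surjective : Function.Surjective (mk K (α := α)) := Submodule.mkQ_surjective _

theorem mk_eq_zero {x : PostLiePoly K α} (h : PostLiePoly.Relator K x) : mk K x = 0 :=
  (Submodule.Quotient.mk_eq_zero _).2 (Submodule.subset_span h)

variable {K}

theorem lie_self (x : FreePostLie K α) : br K x x = 0 := by
  obtain ⟨x, rfl⟩ := mk_surjective K x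
  exact mk_eq_zero K (.lie_self x)

theorem jacobi (x y z : FreePostLie K α) :
    br K x (br K y z) - br K (br K x y) z - br K y (br K x z) = 0 := by
  obtain ⟨x, rfl⟩ := mk_surjective K x
  obtain ⟨y, rfl⟩ := mk_surjective K y
  obtain ⟨z, rfl⟩ := mk_surjective K z
  simp only [br_mk, ← map_sub]
  exact mk_eq_zero K (.jacobi x y z)

theorem derivation (x y z : FreePostLie K α) :
    gr K x (br K y z) - br K (gr K x y) z - br K y (gr K x z) = 0 := by
  obtain ⟨x, rfl⟩ := mk_surjective K x
  obtain ⟨y, rfl⟩ := mk_surjective K y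
  obtain ⟨z, rfl⟩ := mk_surjective K z
  simp only [br_mk, gr_mk, ← map_sub]
  exact mk_eq_zero K (.derivation x y z)

theorem bracket_graft (x y z : FreePostLie K α) :
    gr K (br K x y) z - (gr K x (gr K y z) - gr K (gr K x y) z
      - gr K y (gr K x z) + gr K (gr K y x) z) = 0 := by
  obtain ⟨x, rfl⟩ := mk_surjective K x
  obtain ⟨y, rfl⟩ := mk_surjective K y
  obtain ⟨z, rfl⟩ := mk_surjective K z
  simp only [br_mk, gr_mk, ← map_sub, ← map_add]
  exact mk_eq_zero K (.bracket_graft x y z)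

/-- The value in the free post-Lie algebra of a monomial, with variables replaced by `v`. -/
abbrev evalMonomial (v : α → FreePostLie K β) (e : PostLieMonomial α) : FreePostLie K β :=
  e.eval (fun x y => br K x y) (fun x y => gr K x y) v

/-- Evaluation of polynomials. -/
def evalPoly (v : α → FreePostLie K β) : PostLiePoly K α →ₗ[K] FreePostLie K β :=
  Finsupp.linearCombination K (evalMonomial v)

theorem evalPoly_br (v : α → FreePostLie K β) (x y : PostLiePoly K α) :
    evalPoly v (PostLiePoly.br K x y) = br K (evalPoly v x) (evalPoly v y) := by
  induction x using Finsupp.induction_linear with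
  | zero => simp
  | add x x' hx hx' => simp [hx, hx']
  | single a r =>
    induction y using Finsupp.induction_linear with
    | zero => simp
    | add y y' hy hy' => simp only [map_add, hy, hy']
    | single b s =>
      simp only [evalPoly, PostLiePoly.bilin_single, Finsupp.linearCombination_single,
        evalMonomial, PostLieMonomial.eval, map_smul, LinearMap.smul_apply, mul_smul]
      rw [smul_comm]

theorem evalPoly_gr (v : α → FreePostLie K β) (x y : PostLiePoly K α) :
    evalPoly v (PostLiePoly.gr K x y) = gr K (evalPoly v x) (evalPoly v y) := by
  induction x using Finsupp.induction_linear with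
  | zero => simp
  | add x x' hx hx' => simp [hx, hx']
  | single a r =>
    induction y using Finsupp.induction_linear with
    | zero => simp
    | add y y' hy hy' => simp only [map_add, hy, hy']
    | single b s =>
      simp only [evalPoly, PostLiePoly.bilin_single, Finsupp.linearCombination_single,
        evalMonomial, PostLieMonomial.eval, map_smul, LinearMap.smul_apply, mul_smul]
      rw [smul_comm]

theorem evalPoly_relator (v : α → FreePostLie K β) {x : PostLiePoly K α}
    (h : PostLiePoly.Relator K x) : evalPoly v x = 0 := by
  induction h with
  | lie_self x => rw [evalPoly_br, lie_self]
  | jacobi x y z => simp only [map_sub, evalPoly_br, jacobi]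
  | derivation x y z => simp only [map_sub, evalPoly_br, evalPoly_gr, derivation]
  | bracket_graft x y z =>
    simp only [map_sub, map_add, evalPoly_br, evalPoly_gr]
    exact bracket_graft _ _ _
  | br_left x y _ ih => simp [evalPoly_br, ih]
  | br_right x y _ ih => simp [evalPoly_br, ih]
  | gr_left x y _ ih => simp [evalPoly_gr, ih]
  | gr_right x y _ ih => simp [evalPoly_gr, ih]

/-- Substitution: the morphism of post-Lie algebras which sends the generator `a` to `v a`. -/
def subst (v : α → FreePostLie K β) : FreePostLie K α →ₗ[K] FreePostLie K β :=
  Submodule.liftQ _ (evalPoly v) (by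
    exact Submodule.span_le.2 fun x hx => evalPoly_relator v hx)

variable (K) in
/-- The generators. -/
def gen (a : α) : FreePostLie K α := ofMonomial K (.var a)

/-- Renaming of the generators. -/
def rename (f : α → β) : FreePostLie K α →ₗ[K] FreePostLie K β := subst fun a => gen K (f a)

theorem subst_mk (v : α → FreePostLie K β) (x : PostLiePoly K α) :
    subst v (mk K x) = evalPoly v x := rfl

theorem subst_ofMonomial (v : α → FreePostLie K β) (e : PostLieMonomial α) :
    subst v (ofMonomial K e) = evalMonomial v e := by
  rw [ofMonomial, subst_mk, evalPoly, Finsupp.linearCombination_single, one_smul]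

theorem subst_gen (v : α → FreePostLie K β) (a : α) : subst v (gen K a) = v a :=
  subst_ofMonomial v _

theorem subst_br (v : α → FreePostLie K β) (x y : FreePostLie K α) :
    subst v (br K x y) = br K (subst v x) (subst v y) := by
  obtain ⟨x, rfl⟩ := mk_surjective K x
  obtain ⟨y, rfl⟩ := mk_surjective K y
  rw [br_mk, subst_mk, evalPoly_br]; rfl

theorem subst_gr (v : α → FreePostLie K β) (x y : FreePostLie K α) :
    subst v (gr K x y) = gr K (subst v x) (subst v y) := by
  obtain ⟨x, rfl⟩ := mk_surjective K x
  obtain ⟨y, rfl⟩ := mk_surjective K y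
  rw [gr_mk, subst_mk, evalPoly_gr]; rfl

theorem ofMonomial_bracket (e f : PostLieMonomial α) :
    ofMonomial K (.bracket e f) = br K (ofMonomial K e) (ofMonomial K f) := by
  simp [ofMonomial, br_mk, PostLiePoly.bilin_single]

theorem ofMonomial_graft (e f : PostLieMonomial α) :
    ofMonomial K (.graft e f) = gr K (ofMonomial K e) (ofMonomial K f) := by
  simp [ofMonomial, gr_mk, PostLiePoly.bilin_single]

theorem linearMap_ext {M : Type*} [AddCommGroup M] [Module K M] {f g : FreePostLie K α →ₗ[K] M}
    (h : ∀ e, f (ofMonomial K e) = g (ofMonomial K e)) : f = g := by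
  refine LinearMap.ext fun x => ?_
  obtain ⟨x, rfl⟩ := mk_surjective K x
  have : f ∘ₗ mk K = g ∘ₗ mk K := Finsupp.lhom_ext' fun e => LinearMap.ext_ring (h e)
  exact LinearMap.congr_fun this x

theorem subst_subst (v : α → FreePostLie K β) (w : β → FreePostLie K γ) (x : FreePostLie K α) :
    subst w (subst v x) = subst (fun a => subst w (v a)) x := by
  have : subst w ∘ₗ subst v = subst (fun a => subst w (v a)) := by
    refine linearMap_ext fun e => ?_
    rw [LinearMap.comp_apply, subst_ofMonomial, subst_ofMonomial]
    induction e with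
    | var a => rfl
    | bracket x y hx hy =>
      simp only [evalMonomial, PostLieMonomial.eval, subst_br] at hx hy ⊢
      rw [hx, hy]
    | graft x y hx hy =>
      simp only [evalMonomial, PostLieMonomial.eval, subst_gr] at hx hy ⊢
      rw [hx, hy]
  exact LinearMap.congr_fun this x

theorem evalMonomial_gen (e : PostLieMonomial α) :
    evalMonomial (gen K) e = ofMonomial K e := by
  induction e with
  | var a => rfl
  | bracket x y hx hy =>
    simp only [evalMonomial, PostLieMonomial.eval] at hx hy ⊢
    rw [hx, hy, ofMonomial_bracket]
  | graft x y hx hy =>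
    simp only [evalMonomial, PostLieMonomial.eval] at hx hy ⊢
    rw [hx, hy, ofMonomial_graft]

theorem subst_gen_self (x : FreePostLie K α) : subst (gen K) x = x := by
  have : subst (gen K) = (LinearMap.id : FreePostLie K α →ₗ[K] _) := by
    refine linearMap_ext fun e => ?_
    rw [subst_ofMonomial, evalMonomial_gen, LinearMap.id_apply]
  exact LinearMap.congr_fun this x

theorem rename_id (x : FreePostLie K α) : rename (fun a => a) x = x := subst_gen_self x

theorem rename_gen (f : α → β) (a : α) : rename f (gen K a) = gen K (f a) := subst_gen _ a

theorem subst_rename (f : α → β) (w : β → FreePostLie K γ) (x : FreePostLie K α) :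
    subst w (rename f x) = subst (fun a => w (f a)) x := by
  rw [rename, subst_subst]
  simp only [subst_gen]

theorem rename_subst (v : α → FreePostLie K β) (f : β → γ) (x : FreePostLie K α) :
    rename f (subst v x) = subst (fun a => rename f (v a)) x := by
  rw [rename, subst_subst]

theorem rename_rename (f : α → β) (g : β → γ) (x : FreePostLie K α) :
    rename g (rename f x) = rename (fun a => g (f a)) x := by
  rw [rename, subst_rename]; rfl

variable (K) in
/-- The span of the monomials whose variables, with multiplicity, form the multiset `s`. -/
def weightSpace (s : Multiset α) : Submodule K (FreePostLie K α) :=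
  Submodule.span K {x | ∃ e : PostLieMonomial α, e.labels = s ∧ ofMonomial K e = x}

theorem map₂_mem_weightSpace {s t : Multiset α}
    (B : FreePostLie K α →ₗ[K] FreePostLie K α →ₗ[K] FreePostLie K α)
    (op : PostLieMonomial α → PostLieMonomial α → PostLieMonomial α)
    (hop : ∀ e f, B (ofMonomial K e) (ofMonomial K f) = ofMonomial K (op e f))
    (hl : ∀ e f, (op e f).labels = e.labels + f.labels) {x y : FreePostLie K α}
    (hx : x ∈ weightSpace K s) (hy : y ∈ weightSpace K t) : B x y ∈ weightSpace K (s + t) := by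
  induction hx using Submodule.span_induction with
  | zero => simp
  | add a b _ _ ha hb => simpa using add_mem ha hb
  | smul c a _ ha => simpa using Submodule.smul_mem _ c ha
  | mem a ha =>
    obtain ⟨e, he, rfl⟩ := ha
    induction hy using Submodule.span_induction with
    | zero => simp
    | add a b _ _ ha hb => simpa using add_mem ha hb
    | smul c a _ ha => simpa using Submodule.smul_mem _ c ha
    | mem b hb =>
      obtain ⟨f, hf, rfl⟩ := hb
      exact Submodule.subset_span ⟨op e f, by rw [hl, he, hf], (hop e f).symm⟩

theorem evalMonomial_mem (v : α → FreePostLie K β) (s : α → Multiset β)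
    (h : ∀ a, v a ∈ weightSpace K (s a)) (e : PostLieMonomial α) :
    evalMonomial v e ∈ weightSpace K (e.labels.bind s) := by
  induction e with
  | var a => simpa [evalMonomial, PostLieMonomial.eval, PostLieMonomial.labels] using h a
  | bracket x y hx hy =>
    rw [PostLieMonomial.labels, Multiset.add_bind]
    exact map₂_mem_weightSpace (br K) .bracket (fun e f => (ofMonomial_bracket e f).symm)
      (fun _ _ => rfl) hx hy
  | graft x y hx hy =>
    rw [PostLieMonomial.labels, Multiset.add_bind]
    exact map₂_mem_weightSpace (gr K) .graft (fun e f => (ofMonomial_graft e f).symm)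
      (fun _ _ => rfl) hx hy

theorem subst_mem (v : α → FreePostLie K β) (s : α → Multiset β)
    (h : ∀ a, v a ∈ weightSpace K (s a)) {t : Multiset α} {x : FreePostLie K α}
    (hx : x ∈ weightSpace K t) : subst v x ∈ weightSpace K (t.bind s) := by
  induction hx using Submodule.span_induction with
  | zero => simp
  | add a b _ _ ha hb => simpa using add_mem ha hb
  | smul c a _ ha => simpa using Submodule.smul_mem _ c ha
  | mem a ha =>
    obtain ⟨e, rfl, rfl⟩ := ha
    rw [subst_ofMonomial]
    exact evalMonomial_mem v s h e

theorem rename_mem (f : α → β) {t : Multiset α} {x : FreePostLie K α}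
    (hx : x ∈ weightSpace K t) : rename f x ∈ weightSpace K (t.map f) := by
  have := subst_mem (K := K) (fun a => gen K (f a)) (fun a => {f a})
    (fun a => Submodule.subset_span ⟨.var (f a), rfl, rfl⟩) hx
  rwa [Multiset.bind_singleton] at this

theorem evalMonomial_update_of_notMem [DecidableEq α] (v : α → FreePostLie K β) (i : α)
    (x : FreePostLie K β) (e : PostLieMonomial α) (h : i ∉ e.labels) :
    evalMonomial (Function.update v i x) e = evalMonomial v e := by
  induction e with
  | var a =>
    have : a ≠ i := fun h' => h (by simp [PostLieMonomial.labels, h'])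
    simp [evalMonomial, PostLieMonomial.eval, this]
  | bracket x y hx hy =>
    simp only [PostLieMonomial.labels, Multiset.mem_add, not_or] at h
    simp only [evalMonomial, PostLieMonomial.eval] at hx hy ⊢
    rw [hx h.1, hy h.2]
  | graft x y hx hy =>
    simp only [PostLieMonomial.labels, Multiset.mem_add, not_or] at h
    simp only [evalMonomial, PostLieMonomial.eval] at hx hy ⊢
    rw [hx h.1, hy h.2]

theorem evalMonomial_update_linear [DecidableEq α] (v : α → FreePostLie K β) (i : α)
    (e : PostLieMonomial α) (h : e.labels.count i = 1) :
    ∃ F : FreePostLie K β →ₗ[K] FreePostLie K β,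
      ∀ x, evalMonomial (Function.update v i x) e = F x := by
  induction e with
  | var a =>
    have : a = i := by
      by_contra h'
      simp [PostLieMonomial.labels, Ne.symm h'] at h
    subst this
    exact ⟨LinearMap.id, fun x => by simp [evalMonomial, PostLieMonomial.eval]⟩
  | bracket p q hp hq =>
    rw [PostLieMonomial.labels, Multiset.count_add] at h
    rcases Nat.add_eq_one_iff.1 h with ⟨h0, h1⟩ | ⟨h1, h0⟩
    · obtain ⟨F, hF⟩ := hq h1
      refine ⟨(br K (evalMonomial v p)).comp F, fun x => ?_⟩
      rw [LinearMap.comp_apply, ← hF x,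
        ← evalMonomial_update_of_notMem v i x p (Multiset.count_eq_zero.1 h0)]
      rfl
    · obtain ⟨F, hF⟩ := hp h1
      refine ⟨((br K).flip (evalMonomial v q)).comp F, fun x => ?_⟩
      rw [LinearMap.comp_apply, ← hF x,
        ← evalMonomial_update_of_notMem v i x q (Multiset.count_eq_zero.1 h0)]
      rfl
  | graft p q hp hq =>
    rw [PostLieMonomial.labels, Multiset.count_add] at h
    rcases Nat.add_eq_one_iff.1 h with ⟨h0, h1⟩ | ⟨h1, h0⟩
    · obtain ⟨F, hF⟩ := hq h1
      refine ⟨(gr K (evalMonomial v p)).comp F, fun x => ?_⟩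
      rw [LinearMap.comp_apply, ← hF x,
        ← evalMonomial_update_of_notMem v i x p (Multiset.count_eq_zero.1 h0)]
      rfl
    · obtain ⟨F, hF⟩ := hp h1
      refine ⟨((gr K).flip (evalMonomial v q)).comp F, fun x => ?_⟩
      rw [LinearMap.comp_apply, ← hF x,
        ← evalMonomial_update_of_notMem v i x q (Multiset.count_eq_zero.1 h0)]
      rfl

theorem subst_update_linear [Fintype α] [DecidableEq α] (v : α → FreePostLie K β) (i : α)
    {z : FreePostLie K α} (hz : z ∈ weightSpace K (Finset.univ.val : Multiset α)) :
    ∃ F : FreePostLie K β →ₗ[K] FreePostLie K β,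
      ∀ x, subst (Function.update v i x) z = F x := by
  induction hz using Submodule.span_induction with
  | zero => exact ⟨0, fun x => by simp⟩
  | add a b _ _ ha hb =>
    obtain ⟨F, hF⟩ := ha
    obtain ⟨G, hG⟩ := hb
    exact ⟨F + G, fun x => by simp [hF, hG]⟩
  | smul c a _ ha =>
    obtain ⟨F, hF⟩ := ha
    exact ⟨c • F, fun x => by simp [hF]⟩
  | mem a ha =>
    obtain ⟨e, he, rfl⟩ := ha
    obtain ⟨F, hF⟩ := evalMonomial_update_linear v i e (by
      rw [he]; exact Multiset.count_eq_one_of_mem Finset.univ.nodup (Finset.mem_univ i))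
    exact ⟨F, fun x => by rw [subst_ofMonomial, hF]⟩

end FreePostLie

/-- The space of `n`-ary operations of the post-Lie operad: the multilinear part of the free
post-Lie algebra on `n` generators, spanned by the monomials which contain each generator exactly
once. -/
def PostLie (K : Type*) [Field K] (n : ℕ) : Submodule K (FreePostLie K (Fin n)) :=
  FreePostLie.weightSpace K (Finset.univ.val : Multiset (Fin n))

instance (K : Type*) [Field K] (n : ℕ) : AddCommGroup (PostLie K n) :=
  Submodule.addCommGroup (PostLie K n)

namespace PostLie

open FreePostLie

variable {K : Type*} [Field K]

theorem univ_bind_blocks {n : ℕ} (k : Fin n → ℕ) :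
    (Finset.univ.val : Multiset (Fin n)).bind
      (fun i => (Finset.univ.val : Multiset (Fin (k i))).map fun l => finSigmaFinEquiv ⟨i, l⟩) =
      (Finset.univ.val : Multiset (Fin (∑ i, k i))) := by
  have h : (Finset.univ.val : Multiset (Fin (∑ i, k i))) =
      (Finset.univ.val : Multiset ((i : Fin n) × Fin (k i))).map finSigmaFinEquiv := by
    rw [← Finset.map_univ_equiv finSigmaFinEquiv]; rfl
  rw [h, ← Finset.univ_sigma_univ]
  simp only [Finset.sigma, Multiset.sigma]
  rw [Multiset.map_bind]
  simp only [Multiset.map_map, Function.comp_def]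

theorem univ_map_perm {n : ℕ} (σ : Equiv.Perm (Fin n)) :
    (Finset.univ.val : Multiset (Fin n)).map σ = Finset.univ.val := by
  conv_rhs => rw [← Finset.map_univ_equiv σ]
  rfl

/-- The action of `Σ_n` by permutation of the generators. -/
def act (n : ℕ) : Equiv.Perm (Fin n) →* Module.End K (PostLie K n) where
  toFun σ := (rename σ).restrict fun x hx => by
    have := rename_mem σ hx
    rwa [univ_map_perm] at this
  map_one' := by
    ext x
    exact rename_id x.1
  map_mul' σ τ := by
    ext x
    exact (rename_rename τ σ x.1).symm

/-- The identity operation. -/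
def one : PostLie K 1 := ⟨gen K 0, Submodule.subset_span ⟨.var 0, rfl, rfl⟩⟩

/-- The substitution of the `x i`, with generators relabelled blockwise, for the generators. -/
def compFun {n : ℕ} (k : Fin n → ℕ) (x : ∀ i, PostLie K (k i)) :
    PostLie K n →ₗ[K] PostLie K (∑ i, k i) :=
  (subst fun i => rename (fun l => finSigmaFinEquiv ⟨i, l⟩) (x i).1).restrict fun y hy => by
    have := subst_mem (fun i => rename (fun l => finSigmaFinEquiv ⟨i, l⟩) (x i).1) _
      (fun i => rename_mem (fun l => finSigmaFinEquiv ⟨i, l⟩) (x i).2) hy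
    rwa [univ_bind_blocks] at this

/-- The composition of the post-Lie operad. -/
def comp {n : ℕ} (k : Fin n → ℕ) :
    MultilinearMap K (fun i => PostLie K (k i)) (PostLie K n →ₗ[K] PostLie K (∑ i, k i)) where
  toFun := compFun k
  map_update_add' {inst} x i a b := by
    cases Subsingleton.elim inst (instDecidableEqFin n)
    ext z
    obtain ⟨F, hF⟩ := subst_update_linear
      (fun i => rename (fun l => finSigmaFinEquiv ⟨i, l⟩) (x i).1) i z.2
    have key : ∀ c : PostLie K (k i),
        ((compFun k (Function.update x i c) z : PostLie K (∑ i, k i)) : FreePostLie K _) =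
          F (rename (fun l => finSigmaFinEquiv ⟨i, l⟩) c.1) := fun c => by
      rw [← hF]
      change subst _ z.1 = _
      congr 1
      congr 1
      funext j
      exact Function.apply_update (fun i (c : PostLie K (k i)) =>
        rename (fun l => finSigmaFinEquiv ⟨i, l⟩) c.1) x i c j
    rw [LinearMap.add_apply, Submodule.coe_add, key, key, key, Submodule.coe_add, map_add, map_add]
  map_update_smul' {inst} x i r a := by
    cases Subsingleton.elim inst (instDecidableEqFin n)
    ext z
    obtain ⟨F, hF⟩ := subst_update_linear
      (fun i => rename (fun l => finSigmaFinEquiv ⟨i, l⟩) (x i).1) i z.2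
    have key : ∀ c : PostLie K (k i),
        ((compFun k (Function.update x i c) z : PostLie K (∑ i, k i)) : FreePostLie K _) =
          F (rename (fun l => finSigmaFinEquiv ⟨i, l⟩) c.1) := fun c => by
      rw [← hF]
      change subst _ z.1 = _
      congr 1
      congr 1
      funext j
      exact Function.apply_update (fun i (c : PostLie K (k i)) =>
        rename (fun l => finSigmaFinEquiv ⟨i, l⟩) c.1) x i c j
    rw [LinearMap.smul_apply, Submodule.coe_smul, key, key, Submodule.coe_smul, map_smul, map_smul]

theorem coe_comp {n : ℕ} (k : Fin n → ℕ) (x : ∀ i, PostLie K (k i)) (y : PostLie K n) :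
    (comp k x y : FreePostLie K _) =
      subst (fun i => rename (fun l => finSigmaFinEquiv ⟨i, l⟩) (x i).1) y.1 := rfl

theorem coe_act {n : ℕ} (σ : Equiv.Perm (Fin n)) (x : PostLie K n) :
    (act n σ x : FreePostLie K _) = rename σ x.1 := rfl

theorem coe_arityCast {a b : ℕ} (h : a = b) (x : PostLie K a) :
    ((arityCast (P := fun n => PostLie K n) h x : PostLie K b) : FreePostLie K (Fin b)) =
      rename (Fin.cast h) x.1 := by
  subst h
  exact (rename_id x.1).symm

theorem sum_castLE {N a : ℕ} (h : a ≤ N) (f : Fin N → ℕ) :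
    ∑ i : Fin a, f (Fin.castLE h i) =
      ∑ i ∈ Finset.range a, if hi : i < N then f ⟨i, hi⟩ else 0 := by
  rw [Finset.sum_range]
  refine Finset.sum_congr rfl fun i _ => ?_
  rw [dif_pos (i.2.trans_le h)]
  rfl

theorem blocks_val_aux {m : ℕ} (n : Fin m → ℕ) (k : ∀ j, Fin (n j) → ℕ) (j : ℕ) (hj : j ≤ m) :
    (∑ i ∈ Finset.range (∑ i : Fin j, n (Fin.castLE hj i)),
      if hi : i < ∑ j, n j then
        k (finSigmaFinEquiv.symm ⟨i, hi⟩).1 (finSigmaFinEquiv.symm ⟨i, hi⟩).2 else 0) =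
      ∑ i : Fin j, ∑ l, k (Fin.castLE hj i) l := by
  induction j with
  | zero => simp
  | succ j ih =>
    rw [Fin.sum_univ_castSucc, Fin.sum_univ_castSucc, Finset.sum_range_add]
    have ih' := ih (by omega)
    congr 1
    rw [Finset.sum_range]
    refine Finset.sum_congr rfl fun l _ => ?_
    have hv : ((finSigmaFinEquiv ⟨Fin.castLE hj (Fin.last j), l⟩ : Fin (∑ j, n j)) : ℕ) =
        ∑ i : Fin j, n (Fin.castLE hj i.castSucc) + l := finSigmaFinEquiv_apply _
    have hlt : ∑ i : Fin j, n (Fin.castLE hj i.castSucc) + l < ∑ j, n j :=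
      hv ▸ (finSigmaFinEquiv ⟨Fin.castLE hj (Fin.last j), l⟩).2
    have hp : (⟨_, hlt⟩ : Fin (∑ j, n j)) = finSigmaFinEquiv ⟨Fin.castLE hj (Fin.last j), l⟩ :=
      Fin.ext hv.symm
    rw [dif_pos hlt, hp, Equiv.symm_apply_apply]

theorem blocks_val {m : ℕ} (n : Fin m → ℕ) (k : ∀ j, Fin (n j) → ℕ) (j : Fin m) (l : Fin (n j))
    (t : Fin (k j l)) (p : Fin (∑ j, n j))
    (t' : Fin (k (finSigmaFinEquiv.symm p).1 (finSigmaFinEquiv.symm p).2))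
    (hp : finSigmaFinEquiv.symm p = ⟨j, l⟩) (ht : (t : ℕ) = t') :
    ((finSigmaFinEquiv (⟨j, finSigmaFinEquiv ⟨l, t⟩⟩ : (j : Fin m) × Fin (∑ l, k j l)) :
      Fin (∑ j, ∑ l, k j l)) : ℕ) =
      (finSigmaFinEquiv (⟨p, t'⟩ : (p : Fin (∑ j, n j)) ×
        Fin (k (finSigmaFinEquiv.symm p).1 (finSigmaFinEquiv.symm p).2)) : ℕ) := by
  rw [Equiv.symm_apply_eq] at hp
  have hpv : (p : ℕ) = ∑ i : Fin j, n (Fin.castLE j.2.le i) + l := by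
    rw [hp, finSigmaFinEquiv_apply]
  rw [finSigmaFinEquiv_apply, finSigmaFinEquiv_apply, finSigmaFinEquiv_apply,
    sum_castLE _ (fun p => k (finSigmaFinEquiv.symm p).1 (finSigmaFinEquiv.symm p).2)]
  simp only [hpv, ← ht]
  rw [Finset.sum_range_add, blocks_val_aux n k j j.2.le, ← add_assoc]
  congr 2
  rw [Finset.sum_range]
  refine Finset.sum_congr rfl fun i _ => ?_
  have hi : ∑ i : Fin j, n (Fin.castLE j.2.le i) + i < ∑ j, n j := by
    have := p.2
    have := i.2
    omega
  have hq : (⟨_, hi⟩ : Fin (∑ j, n j)) = finSigmaFinEquiv ⟨j, Fin.castLE l.2.le i⟩ := by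
    apply Fin.ext
    rw [finSigmaFinEquiv_apply]
    rfl
  rw [dif_pos hi, hq, Equiv.symm_apply_apply]

end PostLie

open FreePostLie in
/-- The post-Lie operad: `n`-ary operations are the multilinear post-Lie polynomials in `n`
generators, and the composition is the substitution of polynomials for generators. -/
def postLieOperad (K : Type*) [Field K] : SymOperad K (fun n => PostLie K n) where
  act := PostLie.act
  one := PostLie.one
  comp := PostLie.comp
  comp_one {n} x := by
    apply Subtype.ext
    rw [PostLie.coe_arityCast, PostLie.coe_comp]
    change rename _ (subst _ (gen K 0)) = _
    rw [subst_gen, rename_rename]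
    convert rename_id x.1 using 3
    funext a
    apply Fin.ext
    simp
  one_comp {n} y := by
    apply Subtype.ext
    rw [PostLie.coe_arityCast, PostLie.coe_comp]
    change rename _ (subst (fun i => rename _ (gen K 0)) y.1) = _
    rw [rename_subst]
    simp only [rename_gen]
    convert subst_gen_self y.1 using 3
    funext a
    congr 1
    apply Fin.ext
    simp
  assoc {m} n k x y z := by
    apply Subtype.ext
    rw [PostLie.coe_arityCast, PostLie.coe_comp, PostLie.coe_comp, PostLie.coe_comp, rename_subst,
      subst_subst]
    congr 2
    funext j
    rw [PostLie.coe_comp, rename_subst, rename_subst, subst_rename]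
    congr 2
    funext l
    rw [rename_rename, rename_rename]
    have key : ∀ (p : Fin (∑ j, n j)) (q : (j : Fin m) × Fin (n j))
        (hq : finSigmaFinEquiv.symm p = q),
        rename (fun t => Fin.cast (sum_blocks n k)
          (finSigmaFinEquiv ⟨q.1, finSigmaFinEquiv ⟨q.2, t⟩⟩)) (x q.1 q.2).1 =
        rename (fun t => finSigmaFinEquiv ⟨p, t⟩)
          (x (finSigmaFinEquiv.symm p).1 (finSigmaFinEquiv.symm p).2).1 := by
      rintro p q rfl
      congr 2
      funext t
      apply Fin.ext
      exact PostLie.blocks_val n k _ _ t p t rfl rfl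
    exact key (finSigmaFinEquiv ⟨j, l⟩) ⟨j, l⟩ (Equiv.symm_apply_apply _ _)
  act_outer {n} σ k x y := by
    apply Subtype.ext
    rw [PostLie.coe_arityCast, PostLie.coe_act, PostLie.coe_comp, PostLie.coe_comp,
      PostLie.coe_act, rename_subst, rename_subst, subst_rename]
    congr 2
    funext i
    rw [rename_rename, rename_rename]
    have key : ∀ (i' j : Fin n) (h : j = σ⁻¹ i'),
        rename (fun t => Fin.cast (Equiv.sum_comp σ⁻¹ k) (finSigmaFinEquiv (n := fun i => k (σ⁻¹ i))
          ⟨i', t⟩)) (x (σ⁻¹ i')).1 =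
        rename (fun t => blockPerm σ k (finSigmaFinEquiv ⟨j, t⟩)) (x j).1 := by
      rintro i' j rfl
      congr 2
      funext t
      have : (Equiv.sigmaCongrLeft (β := fun i => Fin (k i)) σ⁻¹).symm ⟨σ⁻¹ i', t⟩ = ⟨i', t⟩ := by
        rw [Equiv.symm_apply_eq]
        rfl
      simp only [blockPerm, Equiv.trans_apply, Equiv.symm_apply_apply, this]
      rfl
    exact key (σ i) i (by simp)
  act_inner {n} k σ x y := by
    apply Subtype.ext
    rw [PostLie.coe_act, PostLie.coe_comp, PostLie.coe_comp, rename_subst]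
    congr 2
    funext i
    rw [PostLie.coe_act, rename_rename, rename_rename]
    congr 2
    funext t
    simp [blockSum, Equiv.permCongr_apply]

/-! ### Planar rooted trees and Lie brackets of planar rooted trees -/

/-- Planar rooted trees with vertices labelled by `α`: `node a [t₁, …, t_k]` has a root labelled
`a`, to which the roots of `t₁, …, t_k` are attached from left to right. -/
inductive PlanarTree (α : Type) : Type
  | node : α → List (PlanarTree α) → PlanarTree α

namespace PlanarTree

variable {α β : Type}

/-- The single-vertex tree with label `a`. -/
def bullet (a : α) : PlanarTree α := node a []

/-- Relabelling of the vertices. -/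
def map (f : α → β) : PlanarTree α → PlanarTree β
  | node a ts => node (f a) (ts.map fun t => t.map f)

/-- The labels of the vertices. -/
def labels : PlanarTree α → List α
  | node a ts => a :: ts.flatMap fun t => t.labels

/-- The list of all trees obtained by choosing one vertex of a tree and adding edges from this
vertex to the roots of the trees in the ordered forest `w`, in their order and to the left of all
edges going out of this vertex. -/
def graftings (w : List (PlanarTree α)) : PlanarTree α → List (PlanarTree α)
  | node a ts => node a (w ++ ts) :: (List.finRange ts.length).flatMap fun i : Fin ts.length =>
      (graftings w (ts.get i)).map fun t => node a (ts.set i t)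
decreasing_by
  have := List.sizeOf_lt_of_mem (List.get_mem ts i)
  simp only [node.sizeOf_spec]
  omega

/-- For a list `D` of pairs (label, ordered forest): add to each vertex, to the left of all edges
going out of it, edges to the roots of the forests which are paired with its label, in the order
in which they occur in `D`. -/
def insert [DecidableEq α] (D : List (α × List (PlanarTree α))) : PlanarTree α → PlanarTree α
  | node a ts => node a (((D.filter fun p => p.1 = a).flatMap fun p => p.2) ++
      ts.map fun t => t.insert D)

end PlanarTree

section FreeLie

variable (K : Type*) [Field K] {X : Type}

theorem freeLie_induction {p : FreeLieAlgebra K X → Prop} (of : ∀ x, p (FreeLieAlgebra.of K x))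
    (zero : p 0) (add : ∀ a b, p a → p b → p (a + b)) (smul : ∀ (c : K) a, p a → p (c • a))
    (lie : ∀ a b, p a → p b → p ⁅a, b⁆) (a : FreeLieAlgebra K X) : p a := by
  let S : LieSubalgebra K (FreeLieAlgebra K X) :=
    { carrier := {a | p a}
      add_mem' := fun {a b} => add a b
      zero_mem' := zero
      smul_mem' := fun c a => smul c a
      lie_mem' := fun {a b} => lie a b }
  have h : S.incl.comp (FreeLieAlgebra.lift K fun x => (⟨FreeLieAlgebra.of K x, of x⟩ : S)) =
      LieHom.id := by
    ext x
    simp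
  have := LieHom.congr_fun h a
  rw [LieHom.id_apply] at this
  rw [← this]
  exact (FreeLieAlgebra.lift K (fun x => (⟨FreeLieAlgebra.of K x, of x⟩ : S)) a).2

/-- The morphism `x ↦ x + ε d(x)` to the free Lie algebra over the dual numbers. -/
def dualLift (d : X → FreeLieAlgebra K X) :
    FreeLieAlgebra K X →ₗ⁅K⁆ DualNumber K ⊗[K] FreeLieAlgebra K X :=
  FreeLieAlgebra.lift K fun x => 1 ⊗ₜ[K] FreeLieAlgebra.of K x + DualNumber.eps ⊗ₜ[K] d x

/-- The coefficient of `ε`. -/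
def epsCoeff : DualNumber K ⊗[K] FreeLieAlgebra K X →ₗ[K] FreeLieAlgebra K X :=
  (TensorProduct.lid K _).toLinearMap ∘ₗ LinearMap.rTensor _ (TrivSqZeroExt.sndHom K K)

/-- The derivation of the free Lie algebra which extends the map `d` on the generators. -/
def freeLieDerivation (d : X → FreeLieAlgebra K X) : FreeLieAlgebra K X →ₗ[K] FreeLieAlgebra K X :=
  epsCoeff K ∘ₗ (dualLift K d : FreeLieAlgebra K X →ₗ[K] DualNumber K ⊗[K] FreeLieAlgebra K X)

variable {K}

theorem bracket_dual (a b a' b' : FreeLieAlgebra K X) :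
    ⁅(1 : DualNumber K) ⊗ₜ[K] a + DualNumber.eps ⊗ₜ[K] a',
      (1 : DualNumber K) ⊗ₜ[K] b + DualNumber.eps ⊗ₜ[K] b'⁆ =
      1 ⊗ₜ[K] ⁅a, b⁆ + DualNumber.eps ⊗ₜ[K] (⁅a', b⁆ + ⁅a, b'⁆) := by
  have h (u v w z : DualNumber K ⊗[K] FreeLieAlgebra K X) :
      ⁅u + v, w + z⁆ = (⁅u, w⁆ + ⁅u, z⁆) + (⁅v, w⁆ + ⁅v, z⁆) :=
    (add_lie u v (w + z)).trans (by rw [lie_add u w z, lie_add v w z])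
  rw [h]
  simp only [LieAlgebra.ExtendScalars.bracket_tmul, one_mul, mul_one, DualNumber.eps_mul_eps,
    TensorProduct.zero_tmul, TensorProduct.tmul_add]
  abel

theorem freeLieDerivation_of (d : X → FreeLieAlgebra K X) (x : X) :
    freeLieDerivation K d (FreeLieAlgebra.of K x) = d x := by
  simp [freeLieDerivation, dualLift, epsCoeff]

theorem dualLift_eq (d : X → FreeLieAlgebra K X) (a : FreeLieAlgebra K X) :
    dualLift K d a = 1 ⊗ₜ[K] a + DualNumber.eps ⊗ₜ[K] freeLieDerivation K d a := by
  induction a using freeLie_induction with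
  | of x => rw [freeLieDerivation_of, dualLift, FreeLieAlgebra.lift_of_apply]
  | zero => simp
  | add a b ha hb =>
    rw [map_add, ha, hb, map_add, TensorProduct.tmul_add, TensorProduct.tmul_add]
    abel
  | smul c a ha =>
    rw [map_smul, ha, map_smul, smul_add, TensorProduct.tmul_smul, TensorProduct.tmul_smul]
  | lie a b ha hb =>
    have h : dualLift K d ⁅a, b⁆ = 1 ⊗ₜ[K] ⁅a, b⁆ + DualNumber.eps ⊗ₜ[K]
        (⁅freeLieDerivation K d a, b⁆ + ⁅a, freeLieDerivation K d b⁆) := by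
      rw [LieHom.map_lie, ha, hb, bracket_dual]
    rw [h]
    congr 2
    rw [freeLieDerivation, LinearMap.comp_apply]
    change _ = epsCoeff K (dualLift K d ⁅a, b⁆)
    rw [h]
    simp [epsCoeff]
    rfl

theorem freeLieDerivation_lie (d : X → FreeLieAlgebra K X) (a b : FreeLieAlgebra K X) :
    freeLieDerivation K d ⁅a, b⁆ =
      ⁅freeLieDerivation K d a, b⁆ + ⁅a, freeLieDerivation K d b⁆ := by
  change epsCoeff K (dualLift K d ⁅a, b⁆) = _
  rw [LieHom.map_lie, dualLift_eq, dualLift_eq, bracket_dual]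
  simp [epsCoeff]

theorem freeLieDerivation_unique {D E : FreeLieAlgebra K X →ₗ[K] FreeLieAlgebra K X}
    (hD : ∀ a b, D ⁅a, b⁆ = ⁅D a, b⁆ + ⁅a, D b⁆) (hE : ∀ a b, E ⁅a, b⁆ = ⁅E a, b⁆ + ⁅a, E b⁆)
    (h : ∀ x, D (FreeLieAlgebra.of K x) = E (FreeLieAlgebra.of K x)) : D = E := by
  refine LinearMap.ext fun a => ?_
  induction a using freeLie_induction with
  | of x => exact h x
  | zero => simp
  | add a b ha hb => rw [map_add, map_add, ha, hb]
  | smul c a ha => rw [map_smul, map_smul, ha]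
  | lie a b ha hb => rw [hD, hE, ha, hb]

variable (K)

/-- The expansion of Lie polynomials in words by `[a, b] = ab - ba`. -/
def wordExpansion : FreeLieAlgebra K X →ₗ[K] MonoidAlgebra K (FreeMonoid X) :=
  letI : LieRing (MonoidAlgebra K (FreeMonoid X)) := LieRing.ofAssociativeRing
  ((FreeLieAlgebra.lift K fun x => MonoidAlgebra.of K (FreeMonoid X) (FreeMonoid.of x) :
    FreeLieAlgebra K X →ₗ⁅K⁆ MonoidAlgebra K (FreeMonoid X)) :
    FreeLieAlgebra K X →ₗ[K] MonoidAlgebra K (FreeMonoid X))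

end FreeLie

/-- The Lie algebra `Lie(PT)` of Lie polynomials in planar rooted trees with vertices labelled by
`α`, i.e. the free Lie algebra on the set of these trees. -/
abbrev LieTree (K : Type*) [Field K] (α : Type) := FreeLieAlgebra K (PlanarTree α)

namespace LieTree

variable (K : Type*) [Field K] {α β : Type}

/-- A tree as a Lie polynomial. -/
abbrev ofTree (t : PlanarTree α) : LieTree K α := FreeLieAlgebra.of K t

/-- The linear map which sends an ordered forest `w` to the sum over all vertices of `t` of the
grafting of `w` to this vertex. -/
def graftForest (t : PlanarTree α) : MonoidAlgebra K (FreeMonoid (PlanarTree α)) →ₗ[K] LieTree K α :=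
  (Finsupp.linearCombination K fun w : FreeMonoid (PlanarTree α) =>
    ((t.graftings w.toList).map (ofTree K)).sum) ∘ₗ
  { toFun := MonoidAlgebra.coeff
    map_add' := fun _ _ => rfl
    map_smul' := fun _ _ => rfl }

/-- The left grafting `x ▷ y` on Lie polynomials of planar trees: a derivation in `y`, and for a
tree `y` one expands `x` in ordered forests and grafts these to the vertices of `y`. -/
def graft : LieTree K α →ₗ[K] LieTree K α →ₗ[K] LieTree K α where
  toFun x := freeLieDerivation K fun t => graftForest K t (wordExpansion K x)
  map_add' x y := freeLieDerivation_unique (freeLieDerivation_lie _)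
    (fun a b => by
      simp only [LinearMap.add_apply, freeLieDerivation_lie, add_lie, lie_add]; abel)
    (fun t => by simp only [LinearMap.add_apply, freeLieDerivation_of, map_add])
  map_smul' c x := freeLieDerivation_unique (freeLieDerivation_lie _)
    (fun a b => by simp [freeLieDerivation_lie])
    (fun t => by
      simp only [LinearMap.smul_apply, freeLieDerivation_of, map_smul, RingHom.id_apply])

/-- The defining rules of the left grafting: for trees `s`, `t` it is the sum over all ways to add
an edge from a vertex of `t` to the root of `s`, leftmost at this vertex, and it is extended to Lie
polynomials by the two further rules. -/
structure IsLeftGrafting (g : LieTree K α →ₗ[K] LieTree K α →ₗ[K] LieTree K α) : Prop where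
  tree_tree (s t : PlanarTree α) :
    g (ofTree K s) (ofTree K t) = ((t.graftings [s]).map (ofTree K)).sum
  lie_right (x y z : LieTree K α) : g x ⁅y, z⁆ = ⁅g x y, z⁆ + ⁅y, g x z⁆
  lie_left (x y z : LieTree K α) :
    g ⁅x, y⁆ z = g x (g y z) - g (g x y) z - g y (g x z) + g (g y x) z

/-- Relabelling of the vertices. -/
def relabel (f : α → β) : LieTree K α →ₗ⁅K⁆ LieTree K β :=
  FreeLieAlgebra.lift K fun t => ofTree K (t.map f)

/-- The value of a linear combination of post-Lie monomials when the variable `a` is replaced by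
`v a` and the operations are interpreted as the Lie bracket and the left grafting. -/
def evalPoly (v : α → LieTree K β) : PostLiePoly K α →ₗ[K] LieTree K β :=
  Finsupp.linearCombination K
    (PostLieMonomial.eval (fun x y => ⁅x, y⁆) (fun x y => graft K x y) v)

/-- `e` is an expression of `x` in terms of the Lie bracket, the left grafting and the single-vertex
trees. -/
def IsExpression (e : PostLiePoly K α) (x : LieTree K α) : Prop :=
  evalPoly K (fun a => ofTree K (PlanarTree.bullet a)) e = x

end LieTree

/-- Lie monomials: formal iterated brackets of elements of `X`. -/
inductive LieMonomial (X : Type) : Type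
  | of : X → LieMonomial X
  | bracket : LieMonomial X → LieMonomial X → LieMonomial X

namespace LieMonomial

variable {α β X : Type}

/-- The element of the free Lie algebra represented by a Lie monomial. -/
def toLie (K : Type*) [Field K] : LieMonomial X → FreeLieAlgebra K X
  | of x => FreeLieAlgebra.of K x
  | bracket a b => ⁅a.toLie K, b.toLie K⁆

/-- The labels of the vertices of a Lie monomial of trees. -/
def labels : LieMonomial (PlanarTree α) → List α
  | of t => t.labels
  | bracket a b => a.labels ++ b.labels

/-- The monomial has exactly `n` vertices, and they are labelled bijectively by `Fin n`. -/
def IsLabelled {n : ℕ} (m : LieMonomial (PlanarTree (Fin n))) : Prop :=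
  (m.labels : Multiset (Fin n)) = Finset.univ.val

/-- Relabelling of the vertices. -/
def relabel (f : α → β) : LieMonomial (PlanarTree α) → LieMonomial (PlanarTree β)
  | of t => of (t.map f)
  | bracket a b => bracket (a.relabel f) (b.relabel f)

/-- The signed ordered forests in the expansion of a Lie monomial by `[a, b] = ab - ba`. -/
def words : LieMonomial X → List (ℤ × List X)
  | of x => [(1, [x])]
  | bracket a b =>
    (a.words.flatMap fun p => b.words.map fun q => (p.1 * q.1, p.2 ++ q.2)) ++
    (a.words.flatMap fun p => b.words.map fun q => (-(p.1 * q.1), q.2 ++ p.2))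

/-- Insertion of ordered forests at the vertices of a Lie monomial of trees. -/
def insert [DecidableEq α] (D : List (α × List (PlanarTree α))) :
    LieMonomial (PlanarTree α) → LieMonomial (PlanarTree α)
  | of t => of (t.insert D)
  | bracket a b => bracket (a.insert D) (b.insert D)

end LieMonomial

/-- The signed Lie monomials of trees obtained from a tree by replacing each vertex `i` by the Lie
monomial `v i`. Each edge going out of vertex `i` is made to go out of an arbitrary vertex of `v i`,
to the left of the edges of `v i`; edges which go out of the same vertex keep their left-to-right
order. What replaces the subtree at the end of such an edge is a Lie monomial: its trees are grafted, all to
the chosen vertex, in the orders and with the signs given by `[a, b] = ab - ba`. -/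
def PlanarTree.replacements {α β : Type} [DecidableEq β] (v : α → LieMonomial (PlanarTree β)) :
    PlanarTree α → List (ℤ × LieMonomial (PlanarTree β))
  | .node i ts =>
    (ts.map fun t => (t.replacements v).flatMap fun r => r.2.words.flatMap fun w =>
      (v i).labels.map fun b => (r.1 * w.1, (b, w.2))).sections.map fun c =>
        ((c.map Prod.fst).prod, (v i).insert (c.map Prod.snd))

/-- The signed Lie monomials obtained from a Lie monomial of trees by replacing each vertex `i` by
the Lie monomial `v i`. -/
def LieMonomial.replacements {α β : Type} [DecidableEq β] (v : α → LieMonomial (PlanarTree β)) :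
    LieMonomial (PlanarTree α) → List (ℤ × LieMonomial (PlanarTree β))
  | .of t => t.replacements v
  | .bracket a b => (a.replacements v).flatMap fun p => (b.replacements v).map fun q =>
      (p.1 * q.1, .bracket p.2 q.2)

/-- The space `Lie(PT)_n` spanned by the Lie brackets over planar trees with exactly `n` vertices in
total, labelled bijectively by `{1, …, n}`. -/
def LabelledLieTree (K : Type*) [Field K] (n : ℕ) : Submodule K (LieTree K (Fin n)) :=
  Submodule.span K {x | ∃ m : LieMonomial (PlanarTree (Fin n)), m.IsLabelled ∧ m.toLie K = x}

instance (K : Type*) [Field K] (n : ℕ) : AddCommGroup (LabelledLieTree K n) :=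
  Submodule.addCommGroup (LabelledLieTree K n)

end

/-!
The Lie algebra `Lie(PT)` of planar rooted trees is the free post-Lie algebra on the single-vertex
trees, and the operad in question is the post-Lie operad transported along this isomorphism.

*Post-Lie relations.* A Lie polynomial acts on trees through its expansion in ordered forests. On
the words in trees the grafting of a forest `u` is a derivation `D u`, and on a tree with root `a`
and forest `f` above it, it is `root a f ↦ root a (u * f + D u f)` (`graftOp_root`). Hence the
difference of the two sides of the rule for `[x, y] ▷ z` vanishes on a tree as soon as the
corresponding derivation vanishes on the subtrees above the root (`graftOp_comm`).

*Freeness.* The tree with root `a` and subtrees `t :: ts` is `t ▷ (a with ts)` minus trees of the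
same size with root `a` and fewer edges at the root (`graft_tree_node`). This recursion defines the
inverse morphism on trees and shows that morphisms are determined by the single-vertex trees. A
morphism of Lie algebras which preserves the grafting of trees to trees preserves all graftings
(`LieTree.map_graft`), by induction on the bracket degree of the left factor, since `x ▷ y` has the
same bracket degree as `y`. So substitution of Lie polynomials for vertices is well defined, and
both sides keep track of labels, which gives the isomorphism of the multilinear parts.

*The combinatorial formula.* Simultaneous grafting of Lie polynomials `x₁, …, x_k` to the vertices
of a Lie monomial, where `x_i` is to the left of `x_j` if `i < j` and both go to the same vertex,
satisfies the recursion above: grafting `x` on top of it either attaches `x` to a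
vertex of the monomial, to the left of everything else, or grafts `x` to one of the `x_i`
(`LieMonomial.graft_graftAll`). So substitution sends a tree with root `a` to the simultaneous
grafting of the images of its subtrees to the monomial put in place of `a`
(`LieMonomial.substitute_node`), and expanding multilinearly gives the signed sum of replacements.
-/

noncomputable section

/-! ### Derivations of the algebra of words -/

/-- The free associative algebra on `X`, with basis the words in `X`. -/
abbrev WordAlgebra (K : Type*) [Field K] (X : Type) := MonoidAlgebra K (FreeMonoid X)

namespace WordAlgebra

variable {K : Type*} [Field K] {X : Type}

variable (K) in
/-- A word as an element of the algebra of words. -/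
def word (w : List X) : WordAlgebra K X := MonoidAlgebra.of K (FreeMonoid X) (FreeMonoid.ofList w)

theorem word_nil : word K ([] : List X) = 1 := map_one _

theorem word_append (v w : List X) : word K (v ++ w) = word K v * word K w :=
  map_mul (MonoidAlgebra.of K (FreeMonoid X)) _ _

theorem word_cons (x : X) (w : List X) : word K (x :: w) = word K [x] * word K w :=
  word_append [x] w

theorem word_induction {p : WordAlgebra K X → Prop} (word : ∀ w, p (word K w))
    (add : ∀ a b, p a → p b → p (a + b)) (smul : ∀ (c : K) a, p a → p (c • a))
    (a : WordAlgebra K X) : p a :=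
  MonoidAlgebra.induction_on a (fun w => word w.toList) add smul

theorem hom_ext {M : Type*} [AddCommGroup M] [Module K M] {f g : WordAlgebra K X →ₗ[K] M}
    (h : ∀ w, f (word K w) = g (word K w)) : f = g := by
  refine LinearMap.ext fun a => ?_
  induction a using word_induction with
  | word w => exact h w
  | add a b ha hb => rw [map_add, map_add, ha, hb]
  | smul c a ha => rw [map_smul, map_smul, ha]

/-- The linear extension of a map defined on words. -/
def extend {M : Type*} [AddCommGroup M] [Module K M] (f : List X → M) : WordAlgebra K X →ₗ[K] M :=
  (Finsupp.linearCombination K fun w : FreeMonoid X => f w.toList) ∘ₗ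
  { toFun := MonoidAlgebra.coeff
    map_add' := fun _ _ => rfl
    map_smul' := fun _ _ => rfl }

@[simp]
theorem extend_word {M : Type*} [AddCommGroup M] [Module K M] (f : List X → M) (w : List X) :
    extend (K := K) f (word K w) = f w := by
  change Finsupp.linearCombination K (fun w : FreeMonoid X => f w.toList)
    (Finsupp.single (FreeMonoid.ofList w) 1) = f w
  simp

/-- The derivation with given values on the letters, evaluated at a word. -/
def derivWord (d : X → WordAlgebra K X) : List X → WordAlgebra K X
  | [] => 0
  | x :: w => d x * word K w + word K [x] * derivWord d w

theorem derivWord_append (d : X → WordAlgebra K X) (v w : List X) :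
    derivWord d (v ++ w) = derivWord d v * word K w + word K v * derivWord d w := by
  induction v with
  | nil => simp [derivWord, word_nil]
  | cons x v ih =>
    rw [List.cons_append, derivWord, derivWord, ih, word_append, word_cons x v]
    noncomm_ring

/-- A linear endomorphism which satisfies the Leibniz rule. -/
def IsLeibniz (D : WordAlgebra K X →ₗ[K] WordAlgebra K X) : Prop :=
  ∀ a b, D (a * b) = D a * b + a * D b

theorem IsLeibniz.map_one {D : WordAlgebra K X →ₗ[K] WordAlgebra K X} (hD : IsLeibniz D) :
    D 1 = 0 := by
  simpa using hD 1 1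

theorem IsLeibniz.ext {D E : WordAlgebra K X →ₗ[K] WordAlgebra K X} (hD : IsLeibniz D)
    (hE : IsLeibniz E) (h : ∀ x, D (word K [x]) = E (word K [x])) : D = E := by
  refine hom_ext fun w => ?_
  induction w with
  | nil => rw [word_nil, hD.map_one, hE.map_one]
  | cons x w ih => rw [word_cons, hD, hE, h, ih]

/-- The derivation of the algebra of words with given values on the letters. -/
def derivation (d : X → WordAlgebra K X) : WordAlgebra K X →ₗ[K] WordAlgebra K X :=
  extend (derivWord d)

theorem derivation_letter (d : X → WordAlgebra K X) (x : X) : derivation d (word K [x]) = d x := by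
  simp [derivation, derivWord, word_nil]

theorem derivation_isLeibniz (d : X → WordAlgebra K X) : IsLeibniz (derivation d) := by
  intro a b
  induction a using word_induction with
  | add a a' ha ha' => simp only [add_mul, map_add, ha, ha']; abel
  | smul c a ha => simp only [smul_mul_assoc, map_smul, ha, smul_add]
  | word v =>
    induction b using word_induction with
    | add b b' hb hb' => simp only [mul_add, map_add, hb, hb']; abel
    | smul c b hb => simp only [mul_smul_comm, map_smul, hb, smul_add]
    | word w => simp only [← word_append, derivation, extend_word, derivWord_append]

theorem IsLeibniz.word_eq_zero {D : WordAlgebra K X →ₗ[K] WordAlgebra K X} (hD : IsLeibniz D)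
    {w : List X} (h : ∀ x ∈ w, D (word K [x]) = 0) : D (word K w) = 0 := by
  induction w with
  | nil => rw [word_nil, hD.map_one]
  | cons x w ih =>
    rw [word_cons, hD, h x (by simp), ih fun y hy => h y (by simp [hy]), zero_mul, mul_zero,
      add_zero]

theorem IsLeibniz.smul {D : WordAlgebra K X →ₗ[K] WordAlgebra K X} (hD : IsLeibniz D) (c : K) :
    IsLeibniz (c • D) := by
  intro a b
  simp only [LinearMap.smul_apply, hD a b, smul_add, smul_mul_assoc, mul_smul_comm]

theorem IsLeibniz.lie {D E : WordAlgebra K X →ₗ[K] WordAlgebra K X} (hD : IsLeibniz D)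
    (hE : IsLeibniz E) : IsLeibniz (D ∘ₗ E - E ∘ₗ D) := by
  intro a b
  simp only [LinearMap.sub_apply, LinearMap.comp_apply, hE a b, hD a b, map_add, hD (E a) b,
    hD a (E b), hE (D a) b, hE a (D b)]
  noncomm_ring

theorem IsLeibniz.add {D E : WordAlgebra K X →ₗ[K] WordAlgebra K X} (hD : IsLeibniz D)
    (hE : IsLeibniz E) : IsLeibniz (D + E) := by
  intro a b
  simp only [LinearMap.add_apply, hE a b, hD a b]
  noncomm_ring

theorem IsLeibniz.sub {D E : WordAlgebra K X →ₗ[K] WordAlgebra K X} (hD : IsLeibniz D)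
    (hE : IsLeibniz E) : IsLeibniz (D - E) := by
  intro a b
  simp only [LinearMap.sub_apply, hE a b, hD a b]
  noncomm_ring

end WordAlgebra

open WordAlgebra

variable {K : Type*} [Field K] {X : Type}

theorem wordExpansion_of (x : X) : wordExpansion K (FreeLieAlgebra.of K x) = word K [x] := by
  simp [wordExpansion, word]

theorem wordExpansion_lie (x y : FreeLieAlgebra K X) :
    wordExpansion K ⁅x, y⁆ =
      wordExpansion K x * wordExpansion K y - wordExpansion K y * wordExpansion K x := by
  let _ : LieRing (MonoidAlgebra K (FreeMonoid X)) := LieRing.ofAssociativeRing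
  exact LieHom.map_lie (FreeLieAlgebra.lift K fun x =>
    MonoidAlgebra.of K (FreeMonoid X) (FreeMonoid.of x)) x y

/-! ### Grafting of ordered forests -/

namespace PlanarTree

variable {α β : Type}

/-- Structural induction for the nested inductive type of planar trees. -/
theorem recOnChildren {p : PlanarTree α → Prop}
    (h : ∀ a ts, (∀ t ∈ ts, p t) → p (node a ts)) : ∀ t, p t
  | node a ts => h a ts fun t _ => recOnChildren h t

/-- The ordered forests obtained from an ordered forest by adding edges to the roots of the trees
in `w` from one of its vertices, to the left of all other edges going out of this vertex. -/
def forestGraftings (w : List (PlanarTree α)) : List (PlanarTree α) → List (List (PlanarTree α))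
  | [] => []
  | t :: ts => (graftings w t).map (fun t' => t' :: ts) ++
      (forestGraftings w ts).map fun ts' => t :: ts'

theorem graftings_node (w : List (PlanarTree α)) (a : α) (ts : List (PlanarTree α)) :
    graftings w (node a ts) = node a (w ++ ts) :: (forestGraftings w ts).map (node a) := by
  -- Both sides run through the trees of the forest, by recursion and by index respectively.
  have key : ∀ ts : List (PlanarTree α), (forestGraftings w ts) =
      (List.finRange ts.length).flatMap fun i : Fin ts.length =>
        (graftings w (ts.get i)).map fun t => ts.set i t := by
    intro ts
    induction ts with
    | nil => rfl
    | cons t ts ih =>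
      have h : List.finRange (t :: ts).length =
          0 :: (List.finRange ts.length).map Fin.succ := List.finRange_succ
      rw [forestGraftings, ih, h, List.flatMap_cons, List.flatMap_map, List.map_flatMap]
      simp [Function.comp_def]
  rw [graftings, key, List.map_flatMap]
  simp [Function.comp_def]

theorem forestGraftings_length {w ts ts' : List (PlanarTree α)} (h : ts' ∈ forestGraftings w ts) :
    ts'.length = ts.length := by
  induction ts generalizing ts' with
  | nil => simp [forestGraftings] at h
  | cons t ts ih =>
    simp only [forestGraftings, List.mem_append, List.mem_map] at h
    rcases h with ⟨t', _, rfl⟩ | ⟨ts', h, rfl⟩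
    · simp
    · simp [ih h]

variable (K) in
/-- A linear combination of trees as a combination of words of length one. -/
def toWord : (PlanarTree α →₀ K) →ₗ[K] WordAlgebra K (PlanarTree α) :=
  Finsupp.linearCombination K fun t => word K [t]

variable (K) in
/-- A linear combination of trees as a Lie polynomial. -/
def toLieTree : (PlanarTree α →₀ K) →ₗ[K] LieTree K α :=
  Finsupp.linearCombination K fun t => LieTree.ofTree K t

variable (K) in
/-- The linear map which attaches the trees of an ordered forest to a new root labelled `a`. -/
def root (a : α) : WordAlgebra K (PlanarTree α) →ₗ[K] PlanarTree α →₀ K :=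
  extend fun ts => Finsupp.single (node a ts) 1

/-- The sum over all vertices of a tree of the grafting of an ordered forest to this vertex,
linearly extended in the forest. -/
def graftTo (t : PlanarTree α) : WordAlgebra K (PlanarTree α) →ₗ[K] PlanarTree α →₀ K :=
  extend fun w => ((graftings w t).map fun t' => Finsupp.single t' 1).sum

/-- The grafting of a combination of ordered forests to combinations of trees. -/
def graftOp (u : WordAlgebra K (PlanarTree α)) : (PlanarTree α →₀ K) →ₗ[K] PlanarTree α →₀ K :=
  Finsupp.linearCombination K fun t => graftTo t u

/-- The grafting of a combination of ordered forests to combinations of ordered forests, all trees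
to the same vertex. -/
def graftDeriv (u : WordAlgebra K (PlanarTree α)) :
    WordAlgebra K (PlanarTree α) →ₗ[K] WordAlgebra K (PlanarTree α) :=
  derivation fun t => toWord K (graftTo t u)

theorem graftDeriv_isLeibniz (u : WordAlgebra K (PlanarTree α)) : IsLeibniz (graftDeriv u) :=
  derivation_isLeibniz _

@[simp] theorem toWord_single (t : PlanarTree α) :
    toWord K (Finsupp.single t 1) = word K [t] := by simp [toWord]

@[simp] theorem toLieTree_single (t : PlanarTree α) :
    toLieTree K (Finsupp.single t 1) = LieTree.ofTree K t := by simp [toLieTree]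

@[simp] theorem graftOp_single (u : WordAlgebra K (PlanarTree α)) (t : PlanarTree α) :
    graftOp u (Finsupp.single t 1) = graftTo t u := by simp [graftOp]

@[simp] theorem root_word (a : α) (ts : List (PlanarTree α)) :
    root K a (word K ts) = Finsupp.single (node a ts) 1 := extend_word _ _

@[simp] theorem graftTo_word (w : List (PlanarTree α)) (t : PlanarTree α) :
    graftTo t (word K w) = ((graftings w t).map fun t' => Finsupp.single t' 1).sum :=
  extend_word _ _

theorem graftDeriv_letter (u : WordAlgebra K (PlanarTree α)) (t : PlanarTree α) :
    graftDeriv u (word K [t]) = toWord K (graftTo t u) := derivation_letter _ t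

theorem toWord_graftOp (u : WordAlgebra K (PlanarTree α)) (v : PlanarTree α →₀ K) :
    toWord K (graftOp u v) = graftDeriv u (toWord K v) := by
  have : toWord K ∘ₗ graftOp u = graftDeriv u ∘ₗ toWord K :=
    Finsupp.lhom_ext' fun t => LinearMap.ext_ring (by simp [graftDeriv_letter])
  exact LinearMap.congr_fun this v

/-- Grafting a word to a forest, as a sum over the resulting forests. -/
theorem graftDeriv_word (w ts : List (PlanarTree α)) :
    graftDeriv (word K w) (word K ts) = ((forestGraftings w ts).map (word K)).sum := by
  induction ts with
  | nil => rw [word_nil, (graftDeriv_isLeibniz _).map_one]; rfl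
  | cons t ts ih =>
    rw [word_cons, graftDeriv_isLeibniz, graftDeriv_letter, ih, graftTo_word, map_list_sum,
      forestGraftings, List.map_append, List.sum_append, ← List.sum_map_mul_right,
      ← List.sum_map_mul_left]
    simp only [List.map_map, Function.comp_def, toWord_single, ← word_append, List.singleton_append]

theorem graftDeriv_add (u w : WordAlgebra K (PlanarTree α)) :
    graftDeriv (u + w) = graftDeriv u + graftDeriv w :=
  (graftDeriv_isLeibniz _).ext ((graftDeriv_isLeibniz _).add (graftDeriv_isLeibniz _))
    fun t => by simp [graftDeriv_letter]

theorem graftDeriv_smul (c : K) (u : WordAlgebra K (PlanarTree α)) :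
    graftDeriv (c • u) = c • graftDeriv u :=
  (graftDeriv_isLeibniz _).ext ((graftDeriv_isLeibniz _).smul c)
    fun t => by simp [graftDeriv_letter]

theorem graftOp_add (u w : WordAlgebra K (PlanarTree α)) :
    graftOp (u + w) = graftOp u + graftOp w :=
  Finsupp.lhom_ext' fun t => LinearMap.ext_ring (by simp)

theorem graftOp_smul (c : K) (u : WordAlgebra K (PlanarTree α)) :
    graftOp (c • u) = c • graftOp u :=
  Finsupp.lhom_ext' fun t => LinearMap.ext_ring (by simp)

/-- A forest is grafted to a tree either at its root or to the forest above the root. -/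
theorem graftOp_root (u : WordAlgebra K (PlanarTree α)) (a : α) (f : WordAlgebra K (PlanarTree α)) :
    graftOp u (root K a f) = root K a (u * f + graftDeriv u f) := by
  induction u using word_induction with
  | add u u' h h' =>
    simp only [graftOp_add, graftDeriv_add, LinearMap.add_apply, h, h', add_mul, map_add]; abel
  | smul c u h =>
    simp only [graftOp_smul, graftDeriv_smul, LinearMap.smul_apply, h, smul_mul_assoc, map_add,
      map_smul, smul_add]
  | word w =>
    induction f using word_induction with
    | add f f' h h' => simp only [map_add, mul_add, h, h']; abel
    | smul c f h => simp only [map_smul, mul_smul_comm, h, map_add, smul_add]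
    | word ts =>
      rw [root_word, graftOp_single, graftTo_word, graftings_node, graftDeriv_word, map_add,
        ← word_append, root_word, map_list_sum]
      simp [Function.comp_def]

/-- The failure of grafting to be an action of the algebra of words. It measures the grafting of
`u` and `w` to two different vertices, so it is symmetric in `u` and `w`. -/
theorem graftOp_comm (u w : WordAlgebra K (PlanarTree α)) (v : PlanarTree α →₀ K) :
    graftOp (u * w - w * u) v = graftOp u (graftOp w v) - graftOp (graftDeriv u w) v
      - graftOp w (graftOp u v) + graftOp (graftDeriv w u) v := by
  -- On forests the same expression is a derivation; both are shown to vanish by induction on trees.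
  let F : WordAlgebra K (PlanarTree α) →ₗ[K] WordAlgebra K (PlanarTree α) :=
    (graftDeriv u ∘ₗ graftDeriv w - graftDeriv w ∘ₗ graftDeriv u)
      - graftDeriv (graftDeriv u w) + graftDeriv (graftDeriv w u) - graftDeriv (u * w - w * u)
  let Z : (PlanarTree α →₀ K) →ₗ[K] PlanarTree α →₀ K :=
    (graftOp u ∘ₗ graftOp w - graftOp w ∘ₗ graftOp u)
      - graftOp (graftDeriv u w) + graftOp (graftDeriv w u) - graftOp (u * w - w * u)
  have hF : IsLeibniz F :=
    (((((graftDeriv_isLeibniz u).lie (graftDeriv_isLeibniz w)).sub (graftDeriv_isLeibniz _)).add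
      (graftDeriv_isLeibniz _)).sub (graftDeriv_isLeibniz _))
  have hFZ (v) : F (toWord K v) = toWord K (Z v) := by
    simp only [F, Z, LinearMap.sub_apply, LinearMap.add_apply, LinearMap.comp_apply, map_sub,
      map_add, toWord_graftOp]
  have hroot (a f) : Z (root K a f) = root K a (F f) := by
    simp only [F, Z, LinearMap.sub_apply, LinearMap.add_apply, LinearMap.comp_apply, graftOp_root,
      ← map_sub, ← map_add]
    congr 1
    simp only [mul_add, map_add, graftDeriv_isLeibniz _ _ f]
    noncomm_ring
  have hZ : ∀ t, Z (Finsupp.single t 1) = 0 := recOnChildren fun a ts ih => by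
    rw [← root_word, hroot, hF.word_eq_zero fun t ht => ?_, map_zero]
    rw [← toWord_single, hFZ, ih t ht, map_zero]
  have : Z = 0 := Finsupp.lhom_ext' fun t => LinearMap.ext_ring (by simpa using hZ t)
  have h0 := LinearMap.congr_fun this v
  simp only [Z, LinearMap.sub_apply, LinearMap.add_apply, LinearMap.comp_apply,
    LinearMap.zero_apply] at h0
  rw [← sub_eq_zero, ← neg_eq_zero, ← h0]
  abel

/-! ### The left grafting of Lie polynomials -/

end PlanarTree

namespace LieTree

open PlanarTree

variable {α : Type}

theorem graft_lie_right (x y z : LieTree K α) :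
    graft K x ⁅y, z⁆ = ⁅graft K x y, z⁆ + ⁅y, graft K x z⁆ :=
  freeLieDerivation_lie _ y z

theorem graft_ofTree (x : LieTree K α) (t : PlanarTree α) :
    graft K x (ofTree K t) = toLieTree K (graftTo t (wordExpansion K x)) := by
  have : graftForest K t = toLieTree K ∘ₗ graftTo t := hom_ext fun w => by
    change extend (fun w => ((t.graftings w).map (ofTree K)).sum) _ = _
    rw [extend_word, LinearMap.comp_apply, graftTo_word, map_list_sum]
    simp [Function.comp_def]
  rw [← LinearMap.comp_apply, ← this]
  exact freeLieDerivation_of _ t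

theorem graft_toLieTree (x : LieTree K α) (v : PlanarTree α →₀ K) :
    graft K x (toLieTree K v) = toLieTree K (graftOp (wordExpansion K x) v) := by
  have : graft K x ∘ₗ toLieTree K = toLieTree K ∘ₗ graftOp (wordExpansion K x) :=
    Finsupp.lhom_ext' fun t => LinearMap.ext_ring (by simpa using graft_ofTree x t)
  exact LinearMap.congr_fun this v

theorem wordExpansion_toLieTree (v : PlanarTree α →₀ K) :
    wordExpansion K (toLieTree K v) = toWord K v := by
  have : wordExpansion K ∘ₗ toLieTree K = toWord K (α := α) :=
    Finsupp.lhom_ext' fun t => LinearMap.ext_ring (by simpa using wordExpansion_of t)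
  exact LinearMap.congr_fun this v

/-- The word expansion turns the left grafting into the action by derivations on words. -/
theorem wordExpansion_graft (x y : LieTree K α) :
    wordExpansion K (graft K x y) = graftDeriv (wordExpansion K x) (wordExpansion K y) := by
  induction y using freeLie_induction with
  | of t => rw [graft_ofTree, wordExpansion_toLieTree, wordExpansion_of, graftDeriv_letter]
  | zero => simp
  | add a b ha hb => simp only [map_add, ha, hb]
  | smul c a ha => simp only [map_smul, ha]
  | lie a b ha hb =>
    rw [graft_lie_right, map_add, wordExpansion_lie, wordExpansion_lie, wordExpansion_lie, ha, hb,
      map_sub, graftDeriv_isLeibniz, graftDeriv_isLeibniz]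
    abel

/-- Both sides are derivations in `z` up to terms that cancel, so the rule reduces to a tree `z`. -/
theorem graft_lie_left (x y z : LieTree K α) :
    graft K ⁅x, y⁆ z = graft K x (graft K y z) - graft K (graft K x y) z
      - graft K y (graft K x z) + graft K (graft K y x) z := by
  induction z using freeLie_induction with
  | of t =>
    have ht : FreeLieAlgebra.of K t = toLieTree K (Finsupp.single t 1) := by simp
    rw [ht]
    simp only [graft_toLieTree, wordExpansion_lie, graftOp_comm, wordExpansion_graft, map_add,
      map_sub]
  | zero => simp
  | add a b ha hb => simp only [map_add, ha, hb]; abel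
  | smul c a ha => simp only [map_smul, ha, smul_add, smul_sub]
  | lie a b ha hb =>
    simp only [graft_lie_right, ha, hb, map_add, add_lie, lie_add, sub_lie, lie_sub]
    abel

theorem graft_isLeftGrafting : IsLeftGrafting K (graft K (α := α)) where
  tree_tree s t := by
    rw [graft_ofTree, wordExpansion_of, graftTo_word, map_list_sum]
    simp [Function.comp_def]
  lie_right := graft_lie_right
  lie_left := graft_lie_left

end LieTree

/-! ### The universal property of the Lie algebra of trees -/

namespace PlanarTree

variable {α : Type}

theorem forestGraftings_labels {w : List (PlanarTree α)} {ts : List (PlanarTree α)}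
    (h : ∀ t ∈ ts, ∀ t' ∈ graftings w t, (t'.labels : Multiset α) =
      (w.flatMap labels : List α) + (t.labels : Multiset α)) :
    ∀ ts' ∈ forestGraftings w ts, (ts'.flatMap labels : Multiset α) =
      (w.flatMap labels : List α) + (ts.flatMap labels : Multiset α) := by
  induction ts with
  | nil => simp [forestGraftings]
  | cons t ts ih =>
    simp only [List.forall_mem_cons] at h
    simp only [forestGraftings, List.mem_append, List.mem_map]
    rintro _ (⟨t', ht', rfl⟩ | ⟨ts', hts', rfl⟩)
    · simp only [List.flatMap_cons, ← Multiset.coe_add, h.1 t' ht', add_assoc]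
    · simp only [List.flatMap_cons, ← Multiset.coe_add, ih h.2 ts' hts', add_left_comm]

theorem graftings_labels (w : List (PlanarTree α)) (t : PlanarTree α) :
    ∀ t' ∈ graftings w t, (t'.labels : Multiset α) =
      (w.flatMap labels : List α) + (t.labels : Multiset α) := by
  induction t using recOnChildren with
  | h a ts ih =>
    simp only [graftings_node, List.mem_cons, List.mem_map]
    rintro _ (rfl | ⟨ts', h, rfl⟩)
    · simp only [labels, List.flatMap_append, ← Multiset.cons_coe, ← Multiset.coe_add,
        Multiset.add_cons]
    · simp only [labels, ← Multiset.cons_coe, forestGraftings_labels ih ts' h, Multiset.add_cons]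

theorem labels_node_of_mem_forestGraftings {a : α} {t : PlanarTree α} {ts ts' : List (PlanarTree α)}
    (h : ts' ∈ forestGraftings [t] ts) :
    ((node a ts').labels : Multiset α) = (node a (t :: ts)).labels := by
  have := forestGraftings_labels (fun t _ => graftings_labels _ t) ts' h
  simp only [labels, ← Multiset.cons_coe, this, List.flatMap_cons, List.flatMap_nil,
    List.append_nil, Multiset.coe_add]

theorem numVertices_grafting {a : α} {t : PlanarTree α} {ts ts' : List (PlanarTree α)}
    (h : ts' ∈ forestGraftings [t] ts) :
    (node a ts').labels.length = (node a (t :: ts)).labels.length :=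
  congrArg Multiset.card (labels_node_of_mem_forestGraftings h)

/-- Induction along the expression of trees by graftings. A tree with root `a` and forest `t :: ts`
above it is, up to trees of the same size with root `a` and fewer edges going out of it, the
grafting of `t` to the tree with root `a` and forest `ts`. The order is lexicographic, by the number
of vertices and the number of edges at the root. -/
theorem graftingInduction {p : PlanarTree α → Prop} (bullet : ∀ a, p (node a []))
    (step : ∀ a t ts, p t → p (node a ts) → (∀ ts' ∈ forestGraftings [t] ts, p (node a ts')) →
      p (node a (t :: ts))) : ∀ t, p t
  | node a [] => bullet a
  | node a (t :: ts) => step a t ts (graftingInduction bullet step t)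
      (graftingInduction bullet step (node a ts))
      (fun ts' _ => graftingInduction bullet step (node a ts'))
termination_by t => (t.labels.length, match t with | node _ ts => ts.length)
decreasing_by
  · apply Prod.Lex.left; simp [labels]
  · apply Prod.Lex.left; cases t; simp [labels]
  · rename_i h
    rw [numVertices_grafting h, forestGraftings_length h]
    apply Prod.Lex.right; simp

end PlanarTree

/-- A bilinear product on a Lie algebra which makes it a post-Lie algebra. -/
structure IsPostLieProduct {L : Type*} [LieRing L] [LieAlgebra K L] (g : L →ₗ[K] L →ₗ[K] L) :
    Prop where
  lie_right (x y z : L) : g x ⁅y, z⁆ = ⁅g x y, z⁆ + ⁅y, g x z⁆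
  lie_left (x y z : L) : g ⁅x, y⁆ z = g x (g y z) - g (g x y) z - g y (g x z) + g (g y x) z

theorem bilin_mem_of_mem_span {M N P : Type*} [AddCommGroup M] [Module K M] [AddCommGroup N]
    [Module K N] [AddCommGroup P] [Module K P] (B : M →ₗ[K] N →ₗ[K] P) {s : Set M} {t : Set N}
    {p : Submodule K P} (h : ∀ x ∈ s, ∀ y ∈ t, B x y ∈ p) {x : M} {y : N}
    (hx : x ∈ Submodule.span K s) (hy : y ∈ Submodule.span K t) : B x y ∈ p := by
  have := Submodule.apply_mem_map₂ B hx hy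
  rw [Submodule.map₂_span_span] at this
  refine Submodule.span_le.2 ?_ this
  rintro _ ⟨x, hx, y, hy, rfl⟩
  exact h x hx y hy

variable (K) in
/-- The Lie bracket as a bilinear map. -/
def lieBilin (L : Type*) [LieRing L] [LieAlgebra K L] : L →ₗ[K] L →ₗ[K] L :=
  LinearMap.mk₂ K (fun x y => ⁅x, y⁆) add_lie smul_lie lie_add fun c x y => lie_smul c x y

theorem list_sum_lie {L ι : Type*} [LieRing L] [LieAlgebra K L] (l : List ι) (f : ι → L) (y : L) :
    ⁅(l.map f).sum, y⁆ = (l.map fun i => ⁅f i, y⁆).sum := by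
  have := map_list_sum ((lieBilin K L).flip y) (l.map f)
  rwa [List.map_map] at this

theorem list_lie_sum {L ι : Type*} [LieRing L] [LieAlgebra K L] (l : List ι) (f : ι → L) (y : L) :
    ⁅y, (l.map f).sum⁆ = (l.map fun i => ⁅y, f i⁆).sum := by
  have := map_list_sum (lieBilin K L y) (l.map f)
  rwa [List.map_map] at this

theorem lie_mem_of_mem_span {L : Type*} [LieRing L] [LieAlgebra K L] {s t : Set L}
    {p : Submodule K L} (h : ∀ x ∈ s, ∀ y ∈ t, ⁅x, y⁆ ∈ p) {x y : L}
    (hx : x ∈ Submodule.span K s) (hy : y ∈ Submodule.span K t) : ⁅x, y⁆ ∈ p :=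
  bilin_mem_of_mem_span (lieBilin K L) h hx hy

theorem LieMonomial.span_range_toLie :
    Submodule.span K (Set.range (LieMonomial.toLie K : LieMonomial X → _)) = ⊤ := by
  refine Submodule.eq_top_iff'.2 fun a => ?_
  induction a using freeLie_induction with
  | of x => exact Submodule.subset_span ⟨.of x, rfl⟩
  | zero => exact zero_mem _
  | add a b ha hb => exact add_mem ha hb
  | smul c a ha => exact Submodule.smul_mem _ c ha
  | lie a b ha hb =>
    refine lie_mem_of_mem_span ?_ ha hb
    rintro _ ⟨m, rfl⟩ _ ⟨m', rfl⟩
    exact Submodule.subset_span ⟨.bracket m m', rfl⟩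

/-- The number of trees in a Lie monomial. -/
def LieMonomial.length : LieMonomial X → ℕ
  | of _ => 1
  | bracket a b => a.length + b.length

theorem LieMonomial.length_pos (m : LieMonomial X) : 0 < m.length := by
  induction m with
  | of => exact one_pos
  | bracket a b ha hb => exact Nat.add_pos_left ha _

namespace LieTree

open PlanarTree

variable {α β : Type}

theorem graft_isPostLieProduct : IsPostLieProduct (graft K (α := α)) :=
  ⟨graft_lie_right, graft_lie_left⟩

variable (K) in
/-- The Lie polynomials of trees which are homogeneous of degree `n` for the bracket. -/
def homogeneous (α : Type) (n : ℕ) : Submodule K (LieTree K α) :=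
  Submodule.span K {x | ∃ m : LieMonomial (PlanarTree α), m.length = n ∧ m.toLie K = x}

theorem lie_mem_homogeneous {n p : ℕ} {x y : LieTree K α} (hx : x ∈ homogeneous K α n)
    (hy : y ∈ homogeneous K α p) : ⁅x, y⁆ ∈ homogeneous K α (n + p) := by
  refine lie_mem_of_mem_span ?_ hx hy
  rintro _ ⟨m, rfl, rfl⟩ _ ⟨m', rfl, rfl⟩
  exact Submodule.subset_span ⟨.bracket m m', rfl, rfl⟩

/-- A derivation which sends trees to combinations of trees preserves the bracket degree. -/
theorem graft_mem_homogeneous (x : LieTree K α) (m : LieMonomial (PlanarTree α)) :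
    graft K x (m.toLie K) ∈ homogeneous K α m.length := by
  induction m with
  | of t =>
    rw [LieMonomial.toLie, graft_ofTree]
    generalize graftTo t (wordExpansion K x) = v
    induction v using Finsupp.induction_linear with
    | zero => simp
    | add v w hv hw => rw [map_add]; exact add_mem hv hw
    | single t c =>
      rw [← mul_one c, ← smul_eq_mul, ← Finsupp.smul_single, map_smul, toLieTree_single]
      exact Submodule.smul_mem _ c (Submodule.subset_span ⟨.of t, rfl, rfl⟩)
  | bracket a b ha hb =>
    rw [LieMonomial.toLie, graft_lie_right]
    exact add_mem (lie_mem_homogeneous ha (Submodule.subset_span ⟨b, rfl, rfl⟩))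
      (lie_mem_homogeneous (Submodule.subset_span ⟨a, rfl, rfl⟩) hb)

section Lift

variable {L : Type*} [LieRing L] [LieAlgebra K L] {g : L →ₗ[K] L →ₗ[K] L}

/-- A morphism of Lie algebras which preserves the grafting of trees to trees preserves all
graftings. The rule for `[x, y] ▷ z` involves `x ▷ y`, which has the same degree for the bracket as
`y`; so the induction is on the degree of the left factor. -/
theorem map_graft (hg : IsPostLieProduct g) (F : LieTree K α →ₗ⁅K⁆ L)
    (hF : ∀ s t : PlanarTree α,
      F (graft K (ofTree K s) (ofTree K t)) = g (F (ofTree K s)) (F (ofTree K t)))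
    (x y : LieTree K α) : F (graft K x y) = g (F x) (F y) := by
  -- For a fixed left factor both sides are derivations along `F`, so trees on the right suffice.
  have right (x : LieTree K α)
      (h : ∀ t, F (graft K x (ofTree K t)) = g (F x) (F (ofTree K t))) (y : LieTree K α) :
      F (graft K x y) = g (F x) (F y) := by
    induction y using freeLie_induction with
    | of t => exact h t
    | zero => simp
    | add a b ha hb => simp only [map_add, ha, hb]
    | smul c a ha => simp only [map_smul, ha]
    | lie a b ha hb =>
      rw [graft_lie_right, map_add, LieHom.map_lie, LieHom.map_lie, LieHom.map_lie, hg.lie_right,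
        ha, hb]
  have mono (n : ℕ) : ∀ x ∈ homogeneous K α n, ∀ y, F (graft K x y) = g (F x) (F y) := by
    induction n using Nat.strong_induction_on with
    | _ n ih =>
      intro x hx
      induction hx using Submodule.span_induction with
      | zero => simp
      | add a b _ _ ha hb =>
        intro y
        simp only [map_add, LinearMap.add_apply, ha, hb]
      | smul c a _ ha =>
        intro y
        simp only [map_smul, LinearMap.smul_apply, ha]
      | mem x hx =>
        obtain ⟨m, rfl, rfl⟩ := hx
        cases m with
        | of s => exact right _ (hF s)
        | bracket a b =>
          intro y
          have hla : a.length < (LieMonomial.bracket a b).length :=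
            Nat.lt_add_of_pos_right b.length_pos
          have hlb : b.length < (LieMonomial.bracket a b).length :=
            Nat.lt_add_of_pos_left a.length_pos
          have ha := ih _ hla _ (Submodule.subset_span ⟨a, rfl, rfl⟩)
          have hb := ih _ hlb _ (Submodule.subset_span ⟨b, rfl, rfl⟩)
          have hab := ih _ hlb _ (graft_mem_homogeneous (a.toLie K) b)
          have hba := ih _ hla _ (graft_mem_homogeneous (b.toLie K) a)
          rw [LieMonomial.toLie, graft_lie_left, LieHom.map_lie, hg.lie_left]
          simp only [map_add, map_sub, ha, hb, hab, hba]
  induction (LieMonomial.span_range_toLie (K := K) ▸ Submodule.mem_top : x ∈ Submodule.span K _)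
    using Submodule.span_induction with
  | zero => simp
  | add a b _ _ ha hb => simp only [map_add, LinearMap.add_apply, ha, hb]
  | smul c a _ ha => simp only [map_smul, LinearMap.smul_apply, ha]
  | mem x hx =>
    obtain ⟨m, rfl⟩ := hx
    exact mono _ _ (Submodule.subset_span ⟨m, rfl, rfl⟩) y

variable (K) in
/-- The grafting of `t` to a tree is the tree with `t` attached leftmost to the root, plus the trees
in which `t` is grafted above the root. Read from right to left, this expresses a tree with several
edges at the root by trees which have fewer vertices or fewer edges at the root. -/
theorem graft_tree_node (t : PlanarTree α) (a : α) (ts : List (PlanarTree α)) :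
    graft K (ofTree K t) (ofTree K (node a ts)) = ofTree K (node a (t :: ts)) +
      ((forestGraftings [t] ts).map fun ts' => ofTree K (node a ts')).sum := by
  rw [graft_isLeftGrafting.tree_tree, graftings_node]
  simp [Function.comp_def]

/-- Morphisms of post-Lie algebras from the Lie algebra of trees are determined by their values on
the single-vertex trees. -/
theorem hom_ext_bullet {F G : LieTree K α →ₗ⁅K⁆ L}
    (hF : ∀ x y, F (graft K x y) = g (F x) (F y)) (hG : ∀ x y, G (graft K x y) = g (G x) (G y))
    (h : ∀ a, F (ofTree K (bullet a)) = G (ofTree K (bullet a))) : F = G := by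
  refine FreeLieAlgebra.hom_ext fun t => ?_
  change F (ofTree K t) = G (ofTree K t)
  induction t using graftingInduction with
  | bullet a => exact h a
  | step a t ts ht hts hts' =>
    have hf := congrArg F (graft_tree_node K t a ts)
    have hg := congrArg G (graft_tree_node K t a ts)
    have hs : F ((forestGraftings [t] ts).map fun ts' => ofTree K (node a ts')).sum =
        G ((forestGraftings [t] ts).map fun ts' => ofTree K (node a ts')).sum := by
      simp only [map_list_sum, List.map_map]
      exact congrArg List.sum (List.map_congr_left hts')
    rw [hF, map_add] at hf
    rw [hG, map_add, ← ht, ← hts, ← hs, hf] at hg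
    exact add_right_cancel hg

/-- The values on trees of the morphism of post-Lie algebras with given values on the single-vertex
trees, defined by the recursion of `graft_tree_node`. -/
def liftTree (g : L →ₗ[K] L →ₗ[K] L) (v : α → L) : PlanarTree α → L
  | node a [] => v a
  | node a (t :: ts) => g (liftTree g v t) (liftTree g v (node a ts)) -
      ((forestGraftings [t] ts).attach.map fun p => liftTree g v (node a p.1)).sum
termination_by t => (t.labels.length, match t with | node _ ts => ts.length)
decreasing_by
  · apply Prod.Lex.left; simp [labels]
  · apply Prod.Lex.left; cases t; simp [labels]
  · have h := p.2
    rw [numVertices_grafting h, forestGraftings_length h]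
    apply Prod.Lex.right; simp

/-- The morphism of post-Lie algebras with given values on the single-vertex trees. -/
def lift (g : L →ₗ[K] L →ₗ[K] L) (v : α → L) : LieTree K α →ₗ⁅K⁆ L :=
  FreeLieAlgebra.lift K (liftTree g v)

theorem lift_ofTree (g : L →ₗ[K] L →ₗ[K] L) (v : α → L) (t : PlanarTree α) :
    lift g v (ofTree K t) = liftTree g v t := FreeLieAlgebra.lift_of_apply _ _

theorem lift_bullet (g : L →ₗ[K] L →ₗ[K] L) (v : α → L) (a : α) :
    lift g v (ofTree K (bullet a)) = v a := by
  rw [lift_ofTree, bullet, liftTree]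

theorem attach_map_val {ι M : Type*} (l : List ι) (f : ι → M) :
    (l.attach.map fun p => f p.1) = l.map f := by
  simp

theorem lift_graft (hg : IsPostLieProduct g) (v : α → L) (x y : LieTree K α) :
    lift g v (graft K x y) = g (lift g v x) (lift g v y) := by
  refine map_graft hg _ (fun s t => ?_) x y
  obtain ⟨a, ts⟩ := t
  rw [graft_tree_node, map_add, map_list_sum, lift_ofTree, lift_ofTree, lift_ofTree, liftTree,
    List.map_map, attach_map_val (forestGraftings [s] ts) fun ts' => liftTree g v (node a ts')]
  simp only [Function.comp_def, lift_ofTree, sub_add_cancel]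

end Lift

end LieTree

/-! ### The Lie algebra of trees is the free post-Lie algebra -/

namespace FreePostLie

variable {α β γ : Type}

/-- The free post-Lie algebra as a Lie ring, with the bracket `FreePostLie.br`. -/
instance : LieRing (FreePostLie K α) where
  bracket x y := br K x y
  add_lie x y z := by change br K (x + y) z = br K x z + br K y z; simp
  lie_add x y z := by change br K x (y + z) = br K x y + br K x z; simp
  lie_self x := lie_self x
  leibniz_lie x y z := by
    change br K x (br K y z) = br K (br K x y) z + br K y (br K x z)
    rw [← sub_eq_zero, ← jacobi x y z]
    abel

instance : LieAlgebra K (FreePostLie K α) where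
  lie_smul c x y := (br K x).map_smul c y

theorem lie_def (x y : FreePostLie K α) : ⁅x, y⁆ = br K x y := rfl

theorem gr_isPostLieProduct : IsPostLieProduct (gr K (α := α)) where
  lie_right x y z := by
    rw [← sub_eq_zero, ← derivation x y z]
    simp only [lie_def]
    abel
  lie_left x y z := sub_eq_zero.1 (bracket_graft x y z)

end FreePostLie

namespace LieTree

open FreePostLie PlanarTree

variable {α β γ : Type}

theorem evalPoly_br (v : α → LieTree K β) (x y : PostLiePoly K α) :
    evalPoly K v (PostLiePoly.br K x y) = ⁅evalPoly K v x, evalPoly K v y⁆ := by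
  induction x using Finsupp.induction_linear with
  | zero => simp
  | add x x' hx hx' => simp only [map_add, LinearMap.add_apply, hx, hx', add_lie]
  | single a r =>
    induction y using Finsupp.induction_linear with
    | zero => simp
    | add y y' hy hy' => simp only [map_add, hy, hy', lie_add]
    | single b s =>
      simp only [evalPoly, PostLiePoly.bilin_single, Finsupp.linearCombination_single,
        PostLieMonomial.eval, smul_lie, lie_smul, mul_smul]
      rw [smul_comm]

theorem evalPoly_gr (v : α → LieTree K β) (x y : PostLiePoly K α) :
    evalPoly K v (PostLiePoly.gr K x y) = graft K (evalPoly K v x) (evalPoly K v y) := by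
  induction x using Finsupp.induction_linear with
  | zero => simp
  | add x x' hx hx' => simp only [map_add, LinearMap.add_apply, hx, hx']
  | single a r =>
    induction y using Finsupp.induction_linear with
    | zero => simp
    | add y y' hy hy' => simp only [map_add, hy, hy']
    | single b s =>
      simp only [evalPoly, PostLiePoly.bilin_single, Finsupp.linearCombination_single,
        PostLieMonomial.eval, map_smul, LinearMap.smul_apply, mul_smul]
      rw [smul_comm]

theorem evalPoly_relator (v : α → LieTree K β) {x : PostLiePoly K α}
    (h : PostLiePoly.Relator K x) : evalPoly K v x = 0 := by
  induction h with
  | lie_self x => rw [evalPoly_br, _root_.lie_self]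
  | jacobi x y z =>
    simp only [map_sub, evalPoly_br]
    rw [leibniz_lie]
    abel
  | derivation x y z =>
    simp only [map_sub, evalPoly_br, evalPoly_gr, graft_lie_right]
    abel
  | bracket_graft x y z =>
    simp only [map_sub, map_add, evalPoly_br, evalPoly_gr, graft_lie_left]
    abel
  | br_left x y _ ih => rw [evalPoly_br, ih, zero_lie]
  | br_right x y _ ih => rw [evalPoly_br, ih, lie_zero]
  | gr_left x y _ ih => rw [evalPoly_gr, ih, map_zero, LinearMap.zero_apply]
  | gr_right x y _ ih => rw [evalPoly_gr, ih, map_zero]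

/-- The morphism of post-Lie algebras from the free post-Lie algebra to the Lie algebra of trees
which sends the generator `a` to `v a`. -/
def eval (v : α → LieTree K β) : FreePostLie K α →ₗ[K] LieTree K β :=
  Submodule.liftQ _ (evalPoly K v) (Submodule.span_le.2 fun _ hx => evalPoly_relator v hx)

theorem eval_mk (v : α → LieTree K β) (x : PostLiePoly K α) :
    eval v (mk K x) = evalPoly K v x := rfl

theorem eval_br (v : α → LieTree K β) (x y : FreePostLie K α) :
    eval v (br K x y) = ⁅eval v x, eval v y⁆ := by
  obtain ⟨x, rfl⟩ := mk_surjective K x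
  obtain ⟨y, rfl⟩ := mk_surjective K y
  exact evalPoly_br v x y

theorem eval_gr (v : α → LieTree K β) (x y : FreePostLie K α) :
    eval v (gr K x y) = graft K (eval v x) (eval v y) := by
  obtain ⟨x, rfl⟩ := mk_surjective K x
  obtain ⟨y, rfl⟩ := mk_surjective K y
  exact evalPoly_gr v x y

theorem eval_gen (v : α → LieTree K β) (a : α) : eval v (gen K a) = v a := by
  rw [gen, ofMonomial, eval_mk]
  simp [evalPoly, PostLieMonomial.eval]

/-- Linear maps on the free post-Lie algebra which preserve both operations, to any space with two
operations, are determined by their values on the generators. -/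
theorem freePostLie_ext {M : Type*} [AddCommGroup M] [Module K M] {b g : M → M → M}
    {F G : FreePostLie K α →ₗ[K] M} (hFb : ∀ x y, F (br K x y) = b (F x) (F y))
    (hFg : ∀ x y, F (gr K x y) = g (F x) (F y)) (hGb : ∀ x y, G (br K x y) = b (G x) (G y))
    (hGg : ∀ x y, G (gr K x y) = g (G x) (G y)) (h : ∀ a, F (gen K a) = G (gen K a)) : F = G := by
  refine linearMap_ext fun e => ?_
  induction e with
  | var a => exact h a
  | bracket x y hx hy => rw [ofMonomial_bracket, hFb, hGb, hx, hy]
  | graft x y hx hy => rw [ofMonomial_graft, hFg, hGg, hx, hy]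

theorem eval_subst (v : α → FreePostLie K β) (w : β → LieTree K γ) (x : FreePostLie K α) :
    eval w (subst v x) = eval (fun a => eval w (v a)) x := by
  have : eval w ∘ₗ subst v = eval fun a => eval w (v a) :=
    freePostLie_ext (b := fun x y => ⁅x, y⁆) (g := fun x y => graft K x y)
      (fun x y => by simp only [LinearMap.comp_apply, subst_br, eval_br])
      (fun x y => by simp only [LinearMap.comp_apply, subst_gr, eval_gr])
      (eval_br _) (eval_gr _)
      (fun a => by simp only [LinearMap.comp_apply, subst_gen, eval_gen])
  exact LinearMap.congr_fun this x

variable (K α) in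
/-- The morphism which sends a tree to its expression in terms of the single-vertex trees. -/
def toFreePostLie : LieTree K α →ₗ⁅K⁆ FreePostLie K α := lift (gr K) (gen K)

theorem toFreePostLie_graft (x y : LieTree K α) :
    toFreePostLie K α (graft K x y) = gr K (toFreePostLie K α x) (toFreePostLie K α y) :=
  lift_graft gr_isPostLieProduct _ x y

/-- The extension of `eval v` along the isomorphism with the free post-Lie algebra: the morphism of
post-Lie algebras which sends the single-vertex tree labelled `a` to `v a`. -/
def substitute (v : α → LieTree K β) : LieTree K α →ₗ⁅K⁆ LieTree K β where
  toLinearMap := eval v ∘ₗ (toFreePostLie K α : LieTree K α →ₗ[K] FreePostLie K α)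
  map_lie' {x y} := by
    change eval v (toFreePostLie K α ⁅x, y⁆) = _
    rw [LieHom.map_lie]
    exact eval_br v _ _

theorem substitute_apply (v : α → LieTree K β) (x : LieTree K α) :
    substitute v x = eval v (toFreePostLie K α x) := rfl

theorem substitute_graft (v : α → LieTree K β) (x y : LieTree K α) :
    substitute v (graft K x y) = graft K (substitute v x) (substitute v y) := by
  rw [substitute_apply, toFreePostLie_graft, eval_gr]
  rfl

theorem substitute_bullet (v : α → LieTree K β) (a : α) :
    substitute v (ofTree K (bullet a)) = v a := by
  rw [substitute_apply, toFreePostLie, lift_bullet, eval_gen]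

variable (K α) in
/-- The Lie algebra of trees is the free post-Lie algebra on the single-vertex trees. -/
def freePostLieEquiv : FreePostLie K α ≃ₗ[K] LieTree K α :=
  LinearEquiv.ofLinearMap (eval fun a => ofTree K (bullet a))
    (toFreePostLie K α : LieTree K α →ₗ[K] FreePostLie K α)
    (by
      have : substitute (fun a => ofTree K (bullet a)) = (LieHom.id : LieTree K α →ₗ⁅K⁆ _) :=
        hom_ext_bullet (g := graft K) (substitute_graft _) (fun _ _ => rfl) (substitute_bullet _)
      exact LinearMap.ext fun x => LieHom.congr_fun this x)
    (freePostLie_ext (b := fun x y => br K x y) (g := fun x y => gr K x y)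
      (fun x y => by
        rw [LinearMap.comp_apply, eval_br]
        exact LieHom.map_lie (toFreePostLie K α) _ _)
      (fun x y => by
        rw [LinearMap.comp_apply, eval_gr]
        exact toFreePostLie_graft _ _)
      (fun _ _ => rfl) (fun _ _ => rfl)
      (fun a => by
        rw [LinearMap.comp_apply, eval_gen]
        exact lift_bullet _ _ a))

theorem freePostLieEquiv_apply (x : FreePostLie K α) :
    freePostLieEquiv K α x = eval (fun a => ofTree K (bullet a)) x := rfl

theorem freePostLieEquiv_symm_apply (x : LieTree K α) :
    (freePostLieEquiv K α).symm x = toFreePostLie K α x := rfl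

theorem map_bullet (f : α → β) (a : α) : (bullet a).map f = bullet (f a) := by
  simp [bullet, PlanarTree.map]

theorem forestGraftings_map (f : α → β) (w ts : List (PlanarTree α))
    (h : ∀ t ∈ ts, graftings (w.map (PlanarTree.map f)) (t.map f) =
      (graftings w t).map (PlanarTree.map f)) :
    forestGraftings (w.map (PlanarTree.map f)) (ts.map (PlanarTree.map f)) =
      (forestGraftings w ts).map (List.map (PlanarTree.map f)) := by
  induction ts with
  | nil => rfl
  | cons t ts ih =>
    simp only [List.forall_mem_cons] at h
    simp [forestGraftings, h.1, ih h.2, Function.comp_def]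

theorem graftings_map (f : α → β) (w : List (PlanarTree α)) (t : PlanarTree α) :
    graftings (w.map (PlanarTree.map f)) (t.map f) = (graftings w t).map (PlanarTree.map f) := by
  induction t using recOnChildren with
  | h a ts ih =>
    have hm (ts : List (PlanarTree α)) :
        (node a ts).map f = node (f a) (ts.map (PlanarTree.map f)) := by
      rw [PlanarTree.map]
    rw [hm, graftings_node, graftings_node, forestGraftings_map f w ts ih]
    simp [Function.comp_def, hm]

theorem relabel_ofTree (f : α → β) (t : PlanarTree α) :
    relabel K f (ofTree K t) = ofTree K (t.map f) := FreeLieAlgebra.lift_of_apply _ _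

theorem relabel_graft (f : α → β) (x y : LieTree K α) :
    relabel K f (graft K x y) = graft K (relabel K f x) (relabel K f y) := by
  refine map_graft graft_isPostLieProduct _ (fun s t => ?_) x y
  have := graftings_map f [s] t
  rw [graft_isLeftGrafting.tree_tree, relabel_ofTree, relabel_ofTree,
    graft_isLeftGrafting.tree_tree, ← List.map_singleton, this, map_list_sum]
  simp [Function.comp_def, relabel_ofTree]

/-- Evaluation at relabelled single-vertex trees is the relabelling, since both are morphisms of
post-Lie algebras on the Lie algebra of trees. -/
theorem eval_relabel (f : α → β) (x : FreePostLie K α) :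
    eval (fun a => ofTree K (bullet (f a))) x = relabel K f (freePostLieEquiv K α x) := by
  have : substitute (fun a => ofTree K (bullet (f a))) = relabel K f :=
    hom_ext_bullet (g := graft K) (substitute_graft _) (relabel_graft f) fun a => by
      rw [substitute_bullet, relabel_ofTree, map_bullet]
  rw [← this, substitute_apply, ← freePostLieEquiv_symm_apply, LinearEquiv.symm_apply_apply]

theorem freePostLieEquiv_rename (f : α → β) (x : FreePostLie K α) :
    freePostLieEquiv K β (rename f x) = relabel K f (freePostLieEquiv K α x) := by
  rw [freePostLieEquiv_apply, rename, eval_subst, ← eval_relabel]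
  simp only [eval_gen]

end LieTree

/-! ### Multilinear parts -/

namespace LieMonomial

variable {α : Type}

theorem sum_words_mul (l l' : List (ℤ × List X)) :
    ((l.flatMap fun p => l'.map fun q => (p.1 * q.1, p.2 ++ q.2)).map
      fun p => p.1 • word K p.2).sum =
      (l.map fun p => p.1 • word K p.2).sum * (l'.map fun p => p.1 • word K p.2).sum := by
  induction l with
  | nil => simp
  | cons p l ih =>
    rw [List.flatMap_cons, List.map_append, List.sum_append, ih, List.map_cons, List.sum_cons,
      add_mul, List.map_map]
    congr 1
    clear ih
    induction l' with
    | nil => simp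
    | cons q l' ih' =>
      rw [List.map_cons, List.sum_cons, ih', List.map_cons, List.sum_cons, mul_add,
        Function.comp_apply, word_append, smul_mul_smul_comm]

theorem sum_words_neg_mul (l l' : List (ℤ × List X)) :
    ((l.flatMap fun p => l'.map fun q => (-(p.1 * q.1), q.2 ++ p.2)).map
      fun p => p.1 • word K p.2).sum =
      -((l'.map fun p => p.1 • word K p.2).sum * (l.map fun p => p.1 • word K p.2).sum) := by
  induction l with
  | nil => simp
  | cons p l ih =>
    rw [List.flatMap_cons, List.map_append, List.sum_append, ih, List.map_cons, List.sum_cons,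
      mul_add, neg_add, List.map_map]
    congr 1
    clear ih
    induction l' with
    | nil => simp
    | cons q l' ih' =>
      rw [List.map_cons, List.sum_cons, ih', List.map_cons, List.sum_cons, add_mul, neg_add,
        Function.comp_apply, word_append, smul_mul_smul_comm, neg_smul, mul_comm p.1]

/-- The word expansion of a Lie monomial is the sum of its signed ordered forests. -/
theorem wordExpansion_toLie (m : LieMonomial X) :
    wordExpansion K (m.toLie K) = (m.words.map fun p => p.1 • word K p.2).sum := by
  induction m with
  | of x => simp [toLie, words, wordExpansion_of]
  | bracket a b ha hb =>
    rw [toLie, wordExpansion_lie, ha, hb, words, List.map_append, List.sum_append, sum_words_mul,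
      sum_words_neg_mul, sub_eq_add_neg]

theorem labels_words (m : LieMonomial (PlanarTree α)) :
    ∀ p ∈ m.words, (p.2.flatMap PlanarTree.labels : Multiset α) = m.labels := by
  induction m with
  | of t => simp [words, labels]
  | bracket a b ha hb =>
    intro p hp
    simp only [words, List.mem_append, List.mem_flatMap, List.mem_map] at hp
    rcases hp with ⟨u, hu, v, hv, rfl⟩ | ⟨u, hu, v, hv, rfl⟩
    · rw [List.flatMap_append, ← Multiset.coe_add, ha u hu, hb v hv]; rfl
    · rw [List.flatMap_append, ← Multiset.coe_add, ha u hu, hb v hv, add_comm]; rfl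

end LieMonomial

namespace LieTree

open FreePostLie PlanarTree

variable {α : Type}

variable (K) in
/-- The span of the Lie monomials of trees whose labels, with multiplicity, form the
multiset `s`. -/
def weightSpace (s : Multiset α) : Submodule K (LieTree K α) :=
  Submodule.span K
    {x | ∃ m : LieMonomial (PlanarTree α), (m.labels : Multiset α) = s ∧ m.toLie K = x}

theorem toLie_mem_weightSpace (m : LieMonomial (PlanarTree α)) :
    m.toLie K ∈ weightSpace K (m.labels : Multiset α) :=
  Submodule.subset_span ⟨m, rfl, rfl⟩

theorem lie_mem_weightSpace {s t : Multiset α} {x y : LieTree K α} (hx : x ∈ weightSpace K s)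
    (hy : y ∈ weightSpace K t) : ⁅x, y⁆ ∈ weightSpace K (s + t) := by
  refine lie_mem_of_mem_span ?_ hx hy
  rintro _ ⟨m, rfl, rfl⟩ _ ⟨m', rfl, rfl⟩
  exact Submodule.subset_span ⟨.bracket m m', rfl, rfl⟩

theorem graft_mem_weightSpace {s t : Multiset α} {x y : LieTree K α} (hx : x ∈ weightSpace K s)
    (hy : y ∈ weightSpace K t) : graft K x y ∈ weightSpace K (s + t) := by
  refine bilin_mem_of_mem_span (graft K) ?_ hx hy
  rintro _ ⟨m, rfl, rfl⟩ _ ⟨m', rfl, rfl⟩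
  clear hx hy
  induction m' with
  | of t =>
    simp only [LieMonomial.toLie, graft_ofTree, LieMonomial.wordExpansion_toLie, map_list_sum,
      List.map_map]
    refine list_sum_mem fun z hz => ?_
    obtain ⟨p, hp, rfl⟩ := List.mem_map.1 hz
    simp only [Function.comp_apply, map_zsmul, graftTo_word, map_list_sum, List.map_map]
    refine zsmul_mem (list_sum_mem fun z hz => ?_) _
    obtain ⟨t', ht', rfl⟩ := List.mem_map.1 hz
    refine Submodule.subset_span ⟨.of t', ?_, by simp [LieMonomial.toLie]⟩
    rw [← m.labels_words p hp]
    exact graftings_labels p.2 t t' ht'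
  | bracket a b ha hb =>
    rw [LieMonomial.toLie, graft_lie_right, LieMonomial.labels, ← Multiset.coe_add]
    refine add_mem ?_ ?_
    · rw [← add_assoc]
      exact lie_mem_weightSpace ha (toLie_mem_weightSpace b)
    · rw [add_left_comm]
      exact lie_mem_weightSpace (toLie_mem_weightSpace a) hb

theorem freePostLieEquiv_ofMonomial_mem (e : PostLieMonomial α) :
    freePostLieEquiv K α (ofMonomial K e) ∈ weightSpace K e.labels := by
  rw [freePostLieEquiv_apply]
  induction e with
  | var a =>
    have := eval_gen (K := K) (fun a : α => ofTree K (bullet a)) a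
    rw [gen] at this
    rw [this]
    exact Submodule.subset_span ⟨.of (bullet a), by
      simp [LieMonomial.labels, bullet, PlanarTree.labels, PostLieMonomial.labels], rfl⟩
  | bracket x y hx hy =>
    rw [ofMonomial_bracket, eval_br]
    exact lie_mem_weightSpace hx hy
  | graft x y hx hy =>
    rw [ofMonomial_graft, eval_gr]
    exact graft_mem_weightSpace hx hy

theorem toFreePostLie_ofTree_mem (t : PlanarTree α) :
    toFreePostLie K α (ofTree K t) ∈ FreePostLie.weightSpace K (t.labels : Multiset α) := by
  induction t using graftingInduction with
  | bullet a =>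
    have : toFreePostLie K α (ofTree K (node a [])) = gen K a := lift_bullet _ _ a
    rw [this]
    exact Submodule.subset_span ⟨.var a, by simp [PostLieMonomial.labels, labels], rfl⟩
  | step a t ts ht hts hts' =>
    have h := congrArg (toFreePostLie K α) (graft_tree_node K t a ts)
    rw [toFreePostLie_graft, map_add, ← sub_eq_iff_eq_add, map_list_sum] at h
    rw [← h]
    refine sub_mem ?_ (list_sum_mem fun x hx => ?_)
    · have := map₂_mem_weightSpace (gr K) .graft (fun e f => (ofMonomial_graft e f).symm)
        (fun _ _ => rfl) ht hts
      convert this using 2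
      simp only [labels, List.flatMap_cons, Multiset.coe_add]
      exact Multiset.coe_eq_coe.2 List.perm_middle.symm
    · simp only [List.map_map, List.mem_map, Function.comp_apply] at hx
      obtain ⟨ts', h', rfl⟩ := hx
      rw [← labels_node_of_mem_forestGraftings h']
      exact hts' ts' h'

theorem toFreePostLie_toLie_mem (m : LieMonomial (PlanarTree α)) :
    toFreePostLie K α (m.toLie K) ∈ FreePostLie.weightSpace K (m.labels : Multiset α) := by
  induction m with
  | of t => exact toFreePostLie_ofTree_mem t
  | bracket a b ha hb =>
    rw [LieMonomial.toLie, LieHom.map_lie, FreePostLie.lie_def, LieMonomial.labels,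
      ← Multiset.coe_add]
    exact map₂_mem_weightSpace (br K) .bracket (fun e f => (ofMonomial_bracket e f).symm)
      (fun _ _ => rfl) ha hb

/-- The isomorphism of post-Lie algebras matches the parts with prescribed labels: grafting and
bracket add up labels, and so does the recursion which expresses trees by graftings. -/
theorem map_weightSpace (s : Multiset α) :
    (FreePostLie.weightSpace K s).map (freePostLieEquiv K α : FreePostLie K α →ₗ[K] LieTree K α) =
      weightSpace K s := by
  apply le_antisymm
  · rw [Submodule.map_le_iff_le_comap]
    refine Submodule.span_le.2 ?_
    rintro _ ⟨e, rfl, rfl⟩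
    exact freePostLieEquiv_ofMonomial_mem e
  · refine Submodule.span_le.2 ?_
    rintro _ ⟨m, rfl, rfl⟩
    exact ⟨_, toFreePostLie_toLie_mem m, (freePostLieEquiv K α).apply_symm_apply _⟩

end LieTree

theorem FreePostLie.exists_mk_eq_of_mem_weightSpace {α : Type} {s : Multiset α}
    {x : FreePostLie K α} (hx : x ∈ FreePostLie.weightSpace K s) :
    ∃ e : PostLiePoly K α, (∀ m ∈ e.support, m.labels = s) ∧ FreePostLie.mk K e = x := by
  have hs : FreePostLie.weightSpace K s ≤
      (Finsupp.supported K K {m : PostLieMonomial α | m.labels = s}).map (FreePostLie.mk K) := by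
    refine Submodule.span_le.2 ?_
    rintro _ ⟨e, he, rfl⟩
    exact ⟨_, Finsupp.single_mem_supported K 1 he, rfl⟩
  obtain ⟨e, he, rfl⟩ := hs hx
  exact ⟨e, fun m hm => he hm, rfl⟩

variable (K) in
/-- The restriction of the isomorphism of post-Lie algebras to the `n`-ary operations of the
post-Lie operad and the labelled Lie polynomials of trees. -/
def labelledEquiv (n : ℕ) : PostLie K n ≃ₗ[K] LabelledLieTree K n :=
  (LieTree.freePostLieEquiv K (Fin n)).ofSubmodules _ _ (LieTree.map_weightSpace _)

theorem coe_labelledEquiv {n : ℕ} (x : PostLie K n) :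
    (labelledEquiv K n x : LieTree K (Fin n)) = LieTree.freePostLieEquiv K (Fin n) x := rfl

theorem coe_labelledEquiv_symm {n : ℕ} (x : LabelledLieTree K n) :
    ((labelledEquiv K n).symm x : FreePostLie K (Fin n)) =
      (LieTree.freePostLieEquiv K (Fin n)).symm x := rfl

/-! ### Transport of operad structures -/

section Transport

variable {P Q : ℕ → Type*} [∀ n, AddCommGroup (P n)] [∀ n, Module K (P n)]
  [∀ n, AddCommGroup (Q n)] [∀ n, Module K (Q n)]

omit [∀ n, AddCommGroup (P n)] [∀ n, AddCommGroup (Q n)] in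
theorem map_arityCast (f : ∀ n, P n → Q n) {a b : ℕ} (h : a = b) (x : P a) :
    arityCast h (f a x) = f b (arityCast h x) := by
  subst h
  rfl

/-- The operad structure obtained from isomorphisms of vector spaces with the components of an
operad. -/
def SymOperad.transport (S : SymOperad K P) (e : ∀ n, P n ≃ₗ[K] Q n) : SymOperad K Q where
  act n :=
    { toFun := fun σ => (e n).conj (S.act n σ)
      map_one' := by ext; simp
      map_mul' := fun σ τ => by ext; simp }
  one := e 1 S.one
  comp {n} k := (((e n).arrowCongr (e (∑ i, k i))).toLinearMap).compMultilinearMap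
    ((S.comp k).compLinearMap fun i => (e (k i)).symm.toLinearMap)
  comp_one x := by
    simpa [map_arityCast fun n x => e n x] using congrArg (e _) (S.comp_one ((e _).symm x))
  one_comp y := by
    simpa [map_arityCast fun n x => e n x] using congrArg (e _) (S.one_comp ((e _).symm y))
  assoc n k x y z := by
    simpa [map_arityCast fun n x => e n x] using congrArg (e _)
      (S.assoc n k (fun j l => (e _).symm (x j l)) (fun j => (e _).symm (y j)) ((e _).symm z))
  act_outer σ k x y := by
    simpa [map_arityCast fun n x => e n x] using congrArg (e _)
      (S.act_outer σ k (fun i => (e _).symm (x i)) ((e _).symm y))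
  act_inner k σ x y := by
    simpa using congrArg (e _) (S.act_inner k σ (fun i => (e _).symm (x i)) ((e _).symm y))

/-- The isomorphism between an operad and its transport. -/
def SymOperad.transportIso (S : SymOperad K P) (e : ∀ n, P n ≃ₗ[K] Q n) :
    SymOperad.Iso S (S.transport e) where
  equiv := e
  map_act n σ x := by simp [SymOperad.transport]
  map_one := rfl
  map_comp k x y := by simp [SymOperad.transport]

end Transport

/-! ### Simultaneous grafting -/

section Simultaneous

open Function

variable {β : Type} [DecidableEq β] {M N : Type*} [AddCommGroup M] [Module K M] [AddCommGroup N]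
  [Module K N]

/-- A function of families `φ` of elements of the word algebra is multilinear in the entries whose
index lies in `S`. The other entries are arbitrary. -/
def MultilinearOn (S : Finset β) (Θ : (β → WordAlgebra K X) → M) : Prop :=
  ∀ b ∈ S, ∀ φ, ∃ F : WordAlgebra K X →ₗ[K] M, ∀ x, Θ (update φ b x) = F x

/-- The sum over all `b ∈ S` of the value of `Θ` after `x` is put to the left of the entry at
`b`. -/
def attach (S : Finset β) (x : WordAlgebra K X) (Θ : (β → WordAlgebra K X) → M) :
    (β → WordAlgebra K X) → M :=
  fun φ => ∑ b ∈ S, Θ (update φ b (x * φ b))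

/-- The sum of the values of `Θ` over all ways to distribute the entries of a list among the
elements of `S`, where entries with the same destination are multiplied in their order. The family
`1` is filled from the last entry on, each new factor going to the left. -/
def attachList (S : Finset β) : ((β → WordAlgebra K X) → M) → List (WordAlgebra K X) → M
  | Θ, [] => Θ 1
  | Θ, x :: xs => attachList S (attach S x Θ) xs

/-- The sum over all `b ∈ S` of the value of `Θ` after `D` is applied to the entry at `b`. -/
def deriveSlots (S : Finset β) (D : WordAlgebra K X →ₗ[K] WordAlgebra K X)
    (Θ : (β → WordAlgebra K X) → M) : (β → WordAlgebra K X) → M :=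
  fun φ => ∑ b ∈ S, Θ (update φ b (D (φ b)))

/-- The lists obtained by applying a map to one entry of a list. -/
def deriveEntries {A : Type*} (D : A → A) : List A → List (List A)
  | [] => []
  | x :: xs => (D x :: xs) :: (deriveEntries D xs).map fun xs' => x :: xs'

variable {S : Finset β}

theorem attach_exists_linear {Θ : (β → WordAlgebra K X) → M} (h : MultilinearOn S Θ) :
    ∃ F : WordAlgebra K X →ₗ[K] (β → WordAlgebra K X) → M, ∀ x, attach S x Θ = F x := by
  refine ⟨{ toFun := fun x => attach S x Θ, map_add' := fun x y => ?_, map_smul' := fun c x => ?_ },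
    fun x => rfl⟩
  · funext φ
    simp only [attach, Pi.add_apply, ← Finset.sum_add_distrib]
    refine Finset.sum_congr rfl fun b hb => ?_
    obtain ⟨F, hF⟩ := h b hb φ
    rw [hF, hF, hF, add_mul, map_add]
  · funext φ
    simp only [attach, Pi.smul_apply, Finset.smul_sum, RingHom.id_apply]
    refine Finset.sum_congr rfl fun b hb => ?_
    obtain ⟨F, hF⟩ := h b hb φ
    rw [hF, hF, smul_mul_assoc, map_smul]

theorem MultilinearOn.attach {Θ : (β → WordAlgebra K X) → M} (h : MultilinearOn S Θ)
    (x : WordAlgebra K X) : MultilinearOn S (attach S x Θ) := by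
  intro b hb φ
  have (c : β) : ∃ F : WordAlgebra K X →ₗ[K] M, c ∈ S → ∀ y,
      Θ (update (update φ b y) c (x * update φ b y c)) = F y := by
    by_cases hc : c = b
    · obtain ⟨F, hF⟩ := h b hb φ
      refine ⟨F ∘ₗ LinearMap.mulLeft K x, fun _ y => ?_⟩
      rw [hc, update_self, update_idem, hF]
      rfl
    · obtain ⟨F, hF⟩ := h b hb (update φ c (x * φ c))
      refine ⟨F, fun _ y => ?_⟩
      rw [update_of_ne hc, update_comm (Ne.symm hc), hF]
  choose F hF using this
  refine ⟨∑ c ∈ S, F c, fun y => ?_⟩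
  rw [LinearMap.sum_apply]
  exact Finset.sum_congr rfl fun c hc => hF c hc y

omit [Module K M] in
theorem attach_add (x : WordAlgebra K X) (Θ Ψ : (β → WordAlgebra K X) → M) :
    attach S x (Θ + Ψ) = attach S x Θ + attach S x Ψ :=
  funext fun _ => Finset.sum_add_distrib

theorem attach_smul (x : WordAlgebra K X) (c : K) (Θ : (β → WordAlgebra K X) → M) :
    attach S x (c • Θ) = c • attach S x Θ :=
  funext fun _ => Finset.smul_sum.symm

omit [Module K M] in
theorem attachList_add (Θ Ψ : (β → WordAlgebra K X) → M) (xs : List (WordAlgebra K X)) :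
    attachList S (Θ + Ψ) xs = attachList S Θ xs + attachList S Ψ xs := by
  induction xs generalizing Θ Ψ with
  | nil => rfl
  | cons x xs ih => rw [attachList, attach_add, ih]; rfl

theorem attachList_smul (c : K) (Θ : (β → WordAlgebra K X) → M) (xs : List (WordAlgebra K X)) :
    attachList S (c • Θ) xs = c • attachList S Θ xs := by
  induction xs generalizing Θ with
  | nil => rfl
  | cons x xs ih => rw [attachList, attach_smul, ih]; rfl

theorem map_attachList (L : M →ₗ[K] N) (Θ : (β → WordAlgebra K X) → M)
    (xs : List (WordAlgebra K X)) :
    L (attachList S Θ xs) = attachList S (fun φ => L (Θ φ)) xs := by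
  induction xs generalizing Θ with
  | nil => rfl
  | cons x xs ih =>
    rw [attachList, ih, attachList]
    congr 1
    funext φ
    exact map_sum L _ _

theorem attachList_exists_linear {Θ : (β → WordAlgebra K X) → M} (h : MultilinearOn S Θ)
    (pre post : List (WordAlgebra K X)) :
    ∃ F : WordAlgebra K X →ₗ[K] M, ∀ x, attachList S Θ (pre ++ x :: post) = F x := by
  induction pre generalizing Θ with
  | nil =>
    obtain ⟨F, hF⟩ := attach_exists_linear h
    refine ⟨{ toFun := fun x => attachList S Θ (x :: post), map_add' := ?_, map_smul' := ?_ },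
      fun x => rfl⟩
    · intro x y
      simp only [attachList, hF, map_add, attachList_add]
    · intro c x
      simp only [attachList, hF, map_smul, attachList_smul, RingHom.id_apply]
  | cons y pre ih => exact ih (h.attach y)

/-- By the Leibniz rule, a derivation applied after `x` is put at `b` acts on `x` or on what was at
`b` before. -/
theorem attach_deriveSlots {Θ : (β → WordAlgebra K X) → M} (h : MultilinearOn S Θ)
    {D : WordAlgebra K X →ₗ[K] WordAlgebra K X} (hD : IsLeibniz D) (x : WordAlgebra K X) :
    attach S x (deriveSlots S D Θ) = attach S (D x) Θ + deriveSlots S D (attach S x Θ) := by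
  funext φ
  simp only [attach, deriveSlots, Pi.add_apply]
  rw [Finset.sum_comm (s := S) (t := S)
    (f := fun c b => Θ (update (update φ c (D (φ c))) b (x * update φ c (D (φ c)) b))),
    ← Finset.sum_add_distrib]
  refine Finset.sum_congr rfl fun b hb => ?_
  obtain ⟨F, hF⟩ := h b hb φ
  have key : ∀ c ∈ S, Θ (update (update φ b (x * φ b)) c (D (update φ b (x * φ b) c))) =
      (if c = b then Θ (update φ b (D x * φ b)) else 0) +
        Θ (update (update φ c (D (φ c))) b (x * update φ c (D (φ c)) b)) := by
    intro c _
    split_ifs with hc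
    · subst hc
      rw [update_self, update_self, update_idem, update_idem, hD, hF, hF, hF, map_add]
    · rw [update_of_ne hc, update_of_ne (Ne.symm hc), update_comm hc, zero_add]
  rw [Finset.sum_congr rfl key, Finset.sum_add_distrib, Finset.sum_ite_eq' S b, if_pos hb]

/-- A derivation applied to the distributed entries acts on one of the entries of the list; it kills
the initial family `1`. -/
theorem attachList_deriveSlots {Θ : (β → WordAlgebra K X) → M} (h : MultilinearOn S Θ)
    {D : WordAlgebra K X →ₗ[K] WordAlgebra K X} (hD : IsLeibniz D) (xs : List (WordAlgebra K X)) :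
    attachList S (deriveSlots S D Θ) xs = ((deriveEntries D xs).map (attachList S Θ)).sum := by
  induction xs generalizing Θ with
  | nil =>
    refine Finset.sum_eq_zero fun b hb => ?_
    obtain ⟨F, hF⟩ := h b hb 1
    rw [hF, Pi.one_apply, hD.map_one, map_zero]
  | cons x xs ih =>
    rw [attachList, attach_deriveSlots h hD, attachList_add, ih (h.attach x), deriveEntries,
      List.map_cons, List.sum_cons, List.map_map]
    rfl

end Simultaneous

namespace PlanarTree

open Function

variable {β : Type}

/-- Insertion of `φ b` at each vertex labelled `b`, to the left of the edges going out of it,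
linearly extended in the ordered forests `φ b`. -/
def insertWords (φ : β → WordAlgebra K (PlanarTree β)) : PlanarTree β → PlanarTree β →₀ K
  | node a ts => root K a (φ a * (ts.map fun t => toWord K (insertWords φ t)).prod)

/-- The insertion at the vertices of an ordered forest. -/
def insertForest (φ : β → WordAlgebra K (PlanarTree β)) (ts : List (PlanarTree β)) :
    WordAlgebra K (PlanarTree β) :=
  (ts.map fun t => toWord K (insertWords φ t)).prod

theorem insertWords_node (φ : β → WordAlgebra K (PlanarTree β)) (a : β) (ts : List (PlanarTree β)) :
    insertWords φ (node a ts) = root K a (φ a * insertForest φ ts) := by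
  rw [insertWords, insertForest]

theorem insertForest_cons (φ : β → WordAlgebra K (PlanarTree β)) (t : PlanarTree β)
    (ts : List (PlanarTree β)) :
    insertForest φ (t :: ts) = toWord K (insertWords φ t) * insertForest φ ts := by
  simp [insertForest]

variable [DecidableEq β]

theorem insertForest_update_of_notMem {φ : β → WordAlgebra K (PlanarTree β)} {b : β}
    {x : WordAlgebra K (PlanarTree β)} {ts : List (PlanarTree β)}
    (h : ∀ t ∈ ts, b ∉ t.labels → insertWords (update φ b x) t = insertWords φ t)
    (hb : b ∉ ts.flatMap labels) : insertForest (update φ b x) ts = insertForest φ ts := by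
  rw [insertForest, insertForest]
  congr 1
  refine List.map_congr_left fun t ht => ?_
  rw [h t ht fun hb' => hb (List.mem_flatMap.2 ⟨t, ht, hb'⟩)]

theorem insertWords_update_of_notMem (φ : β → WordAlgebra K (PlanarTree β)) {b : β}
    (x : WordAlgebra K (PlanarTree β)) (t : PlanarTree β) :
    b ∉ t.labels → insertWords (update φ b x) t = insertWords φ t := by
  induction t using recOnChildren with
  | h a ts ih =>
    intro hb
    simp only [labels, List.mem_cons, not_or] at hb
    rw [insertWords_node, insertWords_node, insertForest_update_of_notMem ih hb.2,
      update_of_ne (Ne.symm hb.1)]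

theorem insertForest_linear {ts : List (PlanarTree β)}
    (h : ∀ t ∈ ts, t.labels.Nodup → ∀ b ∈ t.labels, ∀ φ : β → WordAlgebra K (PlanarTree β),
      ∃ F : WordAlgebra K (PlanarTree β) →ₗ[K] PlanarTree β →₀ K,
        ∀ x, insertWords (update φ b x) t = F x)
    (hn : (ts.flatMap labels).Nodup) (b : β) (hb : b ∈ ts.flatMap labels)
    (φ : β → WordAlgebra K (PlanarTree β)) :
    ∃ F : WordAlgebra K (PlanarTree β) →ₗ[K] WordAlgebra K (PlanarTree β),
      ∀ x, insertForest (update φ b x) ts = F x := by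
  induction ts with
  | nil => simp at hb
  | cons t ts ih =>
    rw [List.flatMap_cons, List.nodup_append'] at hn
    rw [List.flatMap_cons, List.mem_append] at hb
    simp only [List.forall_mem_cons] at h
    rcases hb with hb | hb
    · obtain ⟨F, hF⟩ := h.1 hn.1 b hb φ
      refine ⟨LinearMap.mulRight K (insertForest φ ts) ∘ₗ toWord K ∘ₗ F, fun x => ?_⟩
      rw [insertForest_cons, hF, insertForest_update_of_notMem
        (fun t _ => insertWords_update_of_notMem φ x t) (hn.2.2 hb)]
      rfl
    · obtain ⟨F, hF⟩ := ih h.2 hn.2.1 hb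
      refine ⟨LinearMap.mulLeft K (toWord K (insertWords φ t)) ∘ₗ F, fun x => ?_⟩
      rw [insertForest_cons, hF, insertWords_update_of_notMem φ x t fun hb' => hn.2.2 hb' hb]
      rfl

/-- As the labels of the tree are distinct, `φ b` is inserted exactly once. -/
theorem insertWords_linear (t : PlanarTree β) : t.labels.Nodup → ∀ b ∈ t.labels,
    ∀ φ : β → WordAlgebra K (PlanarTree β),
      ∃ F : WordAlgebra K (PlanarTree β) →ₗ[K] PlanarTree β →₀ K,
        ∀ x, insertWords (update φ b x) t = F x := by
  induction t using recOnChildren with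
  | h a ts ih =>
    intro hn b hb φ
    simp only [labels, List.nodup_cons] at hn
    simp only [labels, List.mem_cons] at hb
    by_cases hba : b = a
    · subst hba
      refine ⟨root K b ∘ₗ LinearMap.mulRight K (insertForest φ ts), fun x => ?_⟩
      rw [insertWords_node, update_self, insertForest_update_of_notMem
        (fun t _ => insertWords_update_of_notMem φ x t) hn.1]
      rfl
    · obtain ⟨F, hF⟩ := insertForest_linear ih hn.2 b (hb.resolve_left hba) φ
      refine ⟨root K a ∘ₗ LinearMap.mulLeft K (φ a) ∘ₗ F, fun x => ?_⟩
      rw [insertWords_node, update_of_ne (Ne.symm hba), hF]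
      rfl

theorem graftDeriv_insertForest (u : WordAlgebra K (PlanarTree β))
    (φ : β → WordAlgebra K (PlanarTree β)) {ts : List (PlanarTree β)}
    (h : ∀ t ∈ ts, t.labels.Nodup → graftOp u (insertWords φ t) =
      (t.labels.map fun b => insertWords (update φ b (u * φ b + graftDeriv u (φ b))) t).sum)
    (hn : (ts.flatMap labels).Nodup) :
    graftDeriv u (insertForest φ ts) = ((ts.flatMap labels).map fun b =>
      insertForest (update φ b (u * φ b + graftDeriv u (φ b))) ts).sum := by
  induction ts with
  | nil => exact (graftDeriv_isLeibniz u).map_one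
  | cons t ts ih =>
    rw [List.flatMap_cons, List.nodup_append'] at hn
    simp only [List.forall_mem_cons] at h
    rw [insertForest_cons, graftDeriv_isLeibniz, ← toWord_graftOp, h.1 hn.1, ih h.2 hn.2.1,
      List.flatMap_cons, List.map_append, List.sum_append, map_list_sum, List.map_map,
      ← List.sum_map_mul_right, ← List.sum_map_mul_left]
    congr 2
    · refine List.map_congr_left fun b hb => ?_
      rw [insertForest_cons, insertForest_update_of_notMem
        (fun t _ => insertWords_update_of_notMem φ _ t) (hn.2.2 hb)]
      rfl
    · refine List.map_congr_left fun b hb => ?_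
      rw [insertForest_cons, insertWords_update_of_notMem φ _ t fun hb' => hn.2.2 hb' hb]

/-- If a forest is grafted to a tree with inserted forests, then it is attached to a vertex of the
original tree, to the left of what is inserted there, or it is grafted to an inserted forest. -/
theorem graftOp_insertWords (u : WordAlgebra K (PlanarTree β))
    (φ : β → WordAlgebra K (PlanarTree β)) (t : PlanarTree β) : t.labels.Nodup →
    graftOp u (insertWords φ t) =
      (t.labels.map fun b => insertWords (update φ b (u * φ b + graftDeriv u (φ b))) t).sum := by
  induction t using recOnChildren with
  | h a ts ih =>
    intro hn
    simp only [labels, List.nodup_cons] at hn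
    rw [insertWords_node, graftOp_root, graftDeriv_isLeibniz, graftDeriv_insertForest u φ ih hn.2,
      labels, List.map_cons, List.sum_cons, insertWords_node, update_self,
      insertForest_update_of_notMem (fun t _ => insertWords_update_of_notMem φ _ t) hn.1,
      ← mul_assoc, ← add_assoc, ← add_mul, map_add, ← List.sum_map_mul_left, map_list_sum,
      List.map_map]
    congr 2
    refine List.map_congr_left fun b hb => ?_
    have hba : a ≠ b := fun h => hn.1 (h ▸ hb)
    rw [insertWords_node, update_of_ne hba]
    rfl

/-- The ordered forest which `PlanarTree.insert D` attaches to the vertices labelled `b`. -/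
def forestAt (D : List (β × List (PlanarTree β))) (b : β) : List (PlanarTree β) :=
  (D.filter fun p => p.1 = b).flatMap fun p => p.2

theorem word_forestAt_cons (b : β) (w : List (PlanarTree β)) (D : List (β × List (PlanarTree β))) :
    (fun c => word K (forestAt ((b, w) :: D) c)) =
      update (fun c => word K (forestAt D c)) b (word K w * word K (forestAt D b)) := by
  funext c
  by_cases hc : c = b
  · subst hc
    simp [forestAt, word_append]
  · rw [update_of_ne hc]
    simp [forestAt, Ne.symm hc]

theorem insertWords_forestAt (D : List (β × List (PlanarTree β))) (t : PlanarTree β) :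
    insertWords (fun b => word K (forestAt D b)) t = Finsupp.single (t.insert D) 1 := by
  induction t using recOnChildren with
  | h a ts ih =>
    have : insertForest (fun b => word K (forestAt D b)) ts =
        word K (ts.map fun t => t.insert D) := by
      induction ts with
      | nil => exact word_nil.symm
      | cons t ts ih' =>
        simp only [List.forall_mem_cons] at ih
        rw [insertForest_cons, ih.1, ih' ih.2, toWord_single, List.map_cons, ← word_append,
          List.singleton_append]
    rw [insertWords_node, this, ← word_append, root_word, PlanarTree.insert]
    rfl

end PlanarTree

namespace LieMonomial

open Function PlanarTree

variable {β : Type}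

/-- Insertion at the vertices of a Lie monomial of trees, linearly extended. -/
def insertWords (φ : β → WordAlgebra K (PlanarTree β)) : LieMonomial (PlanarTree β) → LieTree K β
  | of t => toLieTree K (t.insertWords φ)
  | bracket a b => ⁅a.insertWords φ, b.insertWords φ⁆

variable [DecidableEq β]

theorem insertWords_update_of_notMem (φ : β → WordAlgebra K (PlanarTree β)) {b : β}
    (x : WordAlgebra K (PlanarTree β)) (m : LieMonomial (PlanarTree β)) (hb : b ∉ m.labels) :
    m.insertWords (update φ b x) = m.insertWords φ := by
  induction m with
  | of t => rw [insertWords, insertWords, t.insertWords_update_of_notMem φ x hb]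
  | bracket m m' h h' =>
    simp only [labels, List.mem_append, not_or] at hb
    rw [insertWords, insertWords, h hb.1, h' hb.2]

theorem insertWords_multilinearOn (m : LieMonomial (PlanarTree β)) (hn : m.labels.Nodup) :
    MultilinearOn m.labels.toFinset fun φ : β → WordAlgebra K (PlanarTree β) =>
      m.insertWords φ := by
  intro b hb φ
  rw [List.mem_toFinset] at hb
  induction m with
  | of t =>
    obtain ⟨F, hF⟩ := t.insertWords_linear hn b hb φ
    exact ⟨toLieTree K ∘ₗ F, fun x => by simp only [insertWords, hF, LinearMap.comp_apply]⟩
  | bracket m m' h h' =>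
    simp only [labels, List.mem_append] at hb
    rw [labels, List.nodup_append'] at hn
    rcases hb with hb | hb
    · obtain ⟨F, hF⟩ := h hn.1 hb
      refine ⟨(lieBilin K (LieTree K β)).flip (m'.insertWords φ) ∘ₗ F, fun x => ?_⟩
      simp only [LinearMap.comp_apply, ← hF, insertWords,
        insertWords_update_of_notMem φ x m' (hn.2.2 hb)]
      rfl
    · obtain ⟨F, hF⟩ := h' hn.2.1 hb
      refine ⟨lieBilin K (LieTree K β) (m.insertWords φ) ∘ₗ F, fun x => ?_⟩
      simp only [LinearMap.comp_apply, ← hF, insertWords,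
        insertWords_update_of_notMem φ x m fun hb' => hn.2.2 hb' hb]
      rfl

/-- The version of `graftOp_insertWords` for Lie monomials of trees. -/
theorem graft_insertWords (x : LieTree K β) (φ : β → WordAlgebra K (PlanarTree β))
    (m : LieMonomial (PlanarTree β)) (hn : m.labels.Nodup) :
    LieTree.graft K x (m.insertWords φ) = (m.labels.map fun b => m.insertWords (update φ b
      (wordExpansion K x * φ b + graftDeriv (wordExpansion K x) (φ b)))).sum := by
  induction m with
  | of t =>
    rw [insertWords, LieTree.graft_toLieTree, graftOp_insertWords _ φ t hn, map_list_sum,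
      List.map_map]
    rfl
  | bracket m m' h h' =>
    rw [labels, List.nodup_append'] at hn
    rw [insertWords, LieTree.graft_lie_right, h hn.1, h' hn.2.1, labels, List.map_append,
      List.sum_append, list_sum_lie (K := K), list_lie_sum (K := K)]
    congr 2
    · refine List.map_congr_left fun b hb => ?_
      rw [insertWords, insertWords_update_of_notMem φ _ m' (hn.2.2 hb)]
    · refine List.map_congr_left fun b hb => ?_
      rw [insertWords, insertWords_update_of_notMem φ _ m fun hb' => hn.2.2 hb' hb]

theorem insertWords_forestAt (D : List (β × List (PlanarTree β)))
    (m : LieMonomial (PlanarTree β)) :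
    m.insertWords (fun b => word K (forestAt D b)) = (m.insert D).toLie K := by
  induction m with
  | of t => rw [insertWords, PlanarTree.insertWords_forestAt, toLieTree_single]; rfl
  | bracket m m' h h' => rw [insertWords, h, h']; rfl

/-- The simultaneous grafting of Lie polynomials, given by their word expansions, to the vertices of
a Lie monomial of trees. -/
def graftAll (m : LieMonomial (PlanarTree β)) (xs : List (WordAlgebra K (PlanarTree β))) :
    LieTree K β :=
  attachList m.labels.toFinset (fun φ => m.insertWords φ) xs

/-- The simultaneous grafting satisfies the recursion by which trees are expressed in terms of the
left grafting. -/
theorem graft_graftAll (x : LieTree K β) (m : LieMonomial (PlanarTree β)) (hn : m.labels.Nodup)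
    (xs : List (WordAlgebra K (PlanarTree β))) :
    LieTree.graft K x (m.graftAll xs) = m.graftAll (wordExpansion K x :: xs) +
      ((deriveEntries (graftDeriv (wordExpansion K x)) xs).map m.graftAll).sum := by
  have hm := insertWords_multilinearOn (K := K) m hn
  have h : (fun φ => LieTree.graft K x (m.insertWords φ)) =
      attach m.labels.toFinset (wordExpansion K x) (fun φ => m.insertWords φ) +
        deriveSlots m.labels.toFinset (graftDeriv (wordExpansion K x))
          (fun φ => m.insertWords φ) := by
    funext φ
    rw [graft_insertWords x φ m hn, ← List.sum_toFinset _ hn, Pi.add_apply, attach, deriveSlots,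
      ← Finset.sum_add_distrib]
    refine Finset.sum_congr rfl fun b hb => ?_
    obtain ⟨F, hF⟩ := hm b hb φ
    exact (hF _).trans ((map_add F _ _).trans (congrArg₂ _ (hF _).symm (hF _).symm))
  rw [graftAll, map_attachList, h, attachList_add,
    attachList_deriveSlots hm (graftDeriv_isLeibniz _)]
  rfl

end LieMonomial

/-! ### Substitution of Lie monomials for the vertices -/

namespace LieMonomial

open PlanarTree LieTree

variable {α β : Type}

/-- If `f` turns the grafting of `w` to a tree into `D`, then a multilinear `J` turns the graftings
of `w` to an ordered forest into the applications of `D` to one entry. -/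
theorem sum_forestGraftings {M : Type*} [AddCommGroup M] [Module K M]
    {J : List (WordAlgebra K X) → M}
    (hJ : ∀ pre post, ∃ F : WordAlgebra K X →ₗ[K] M, ∀ x, J (pre ++ x :: post) = F x)
    {w : List (PlanarTree α)} {f : PlanarTree α → WordAlgebra K X}
    {D : WordAlgebra K X → WordAlgebra K X} (hf : ∀ t, ((graftings w t).map f).sum = D (f t))
    (ts : List (PlanarTree α)) :
    ((forestGraftings w ts).map fun ts' => J (ts'.map f)).sum =
      ((deriveEntries D (ts.map f)).map J).sum := by
  induction ts generalizing J with
  | nil => rfl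
  | cons t ts ih =>
    obtain ⟨F, hF⟩ := hJ [] (ts.map f)
    have h := ih (J := fun xs => J (f t :: xs)) fun pre post => hJ (f t :: pre) post
    simp only [List.nil_append] at hF
    rw [forestGraftings, List.map_append, List.sum_append, List.map_map, List.map_map,
      List.map_cons, deriveEntries, List.map_cons, List.sum_cons, List.map_map, hF, ← hf,
      map_list_sum, List.map_map]
    simp only [Function.comp_def, List.map_cons, hF]
    rw [h]

variable [DecidableEq β]

theorem graftAll_nil (m : LieMonomial (PlanarTree β)) : m.graftAll [] = m.toLie K := by
  have h := insertWords_forestAt (K := K) [] m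
  have hm : m.insert [] = m := by
    have ht (t : PlanarTree β) : t.insert [] = t := by
      induction t using recOnChildren with
      | h a ts ih =>
        rw [PlanarTree.insert]
        simp only [List.filter_nil, List.flatMap_nil, List.nil_append]
        rw [List.map_congr_left ih, List.map_id']
    induction m with
    | of t => rw [LieMonomial.insert, ht]
    | bracket a b ha hb =>
      rw [LieMonomial.insert, ha (insertWords_forestAt _ _), hb (insertWords_forestAt _ _)]
  rw [hm] at h
  rw [← h]
  exact congrArg m.insertWords (funext fun b => word_nil.symm)

/-- Substitution for the vertices of a tree: what replaces the subtrees above the root is grafted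
simultaneously to what replaces the root. -/
theorem substitute_node {v : α → LieMonomial (PlanarTree β)} (hv : ∀ a, (v a).labels.Nodup) (a : α)
    (ts : List (PlanarTree α)) :
    substitute (fun a => (v a).toLie K) (ofTree K (node a ts)) = (v a).graftAll (ts.map fun t =>
      wordExpansion K (substitute (fun a => (v a).toLie K) (ofTree K t))) := by
  generalize hn : ts.length = n
  induction n generalizing ts with
  | zero =>
    rw [List.length_eq_zero_iff] at hn
    subst hn
    rw [List.map_nil, graftAll_nil]
    exact substitute_bullet _ a
  | succ n ih =>
    obtain _ | ⟨s, ts⟩ := ts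
    · simp at hn
    simp only [List.length_cons, Nat.add_right_cancel_iff] at hn
    have h := congrArg (substitute fun a => (v a).toLie K) (graft_tree_node K s a ts)
    rw [substitute_graft, map_add, ih ts hn, graft_graftAll _ _ (hv a), map_list_sum,
      List.map_map] at h
    rw [List.map_cons]
    -- Both sides satisfy the same recursion; its remaining terms have `n` subtrees at the root.
    refine (add_right_cancel (h.trans (congrArg₂ _ rfl ?_))).symm
    rw [← sum_forestGraftings (J := (v a).graftAll)
      (attachList_exists_linear (insertWords_multilinearOn (v a) (hv a)))
      (w := [s])]
    · refine congrArg List.sum (List.map_congr_left fun ts' hts' => ?_)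
      exact ih ts' ((forestGraftings_length hts').trans hn)
    · intro t
      have ht := congrArg (fun x => wordExpansion K (substitute (fun a => (v a).toLie K) x))
        (graft_isLeftGrafting.tree_tree (K := K) s t)
      simp only [substitute_graft, wordExpansion_graft, map_list_sum, List.map_map] at ht
      exact ht.symm

/-- The simultaneous grafting of signed ordered forests, as a sum over all choices of a forest and
of a vertex for each entry of the list. -/
theorem sum_sections (l : List β) (hl : l.Nodup) {M : Type*} [AddCommGroup M] [Module K M]
    {Θ : (β → WordAlgebra K (PlanarTree β)) → M} (hΘ : MultilinearOn l.toFinset Θ)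
    (L : List (List (ℤ × List (PlanarTree β)))) :
    (((L.map fun rs => rs.flatMap fun r => l.map fun b => (r.1, (b, r.2))).sections).map fun c =>
      (c.map Prod.fst).prod • Θ fun b => word K (forestAt (c.map Prod.snd) b)).sum =
      attachList l.toFinset Θ (L.map fun rs => (rs.map fun r => r.1 • word K r.2).sum) := by
  induction L generalizing Θ with
  | nil =>
    simp only [List.map_nil, List.sections, List.map_cons, List.prod_nil, one_smul, List.sum_cons,
      List.sum_nil, add_zero, attachList]
    exact congrArg Θ (funext fun b => word_nil)
  | cons rs L ih =>
    rw [List.map_cons, List.map_cons, attachList, ← ih (hΘ.attach _)]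
    rw [List.sections, List.flatMap_def, List.map_flatten, List.sum_flatten, List.map_map,
      List.map_map]
    refine congrArg List.sum (List.map_congr_left fun c _ => ?_)
    obtain ⟨F, hF⟩ := attach_exists_linear hΘ
    have hE (x : WordAlgebra K (PlanarTree β)) (φ : β → WordAlgebra K (PlanarTree β)) :
        attach l.toFinset x Θ φ = (LinearMap.proj φ ∘ₗ F) x := by rw [hF]; rfl
    rw [hE, map_list_sum, List.smul_sum, List.flatMap_def, Function.comp_apply,
      Function.comp_apply, List.map_map, List.map_flatten, List.sum_flatten, List.map_map,
      List.map_map, List.map_map, List.map_map]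
    refine congrArg List.sum (List.map_congr_left fun r _ => ?_)
    simp only [Function.comp_apply, ← hE, attach, List.sum_toFinset _ hl, List.map_map,
      List.map_cons, List.prod_cons, word_forestAt_cons, List.smul_sum, Function.comp_def]
    refine congrArg List.sum (List.map_congr_left fun b hb => ?_)
    obtain ⟨G, hG⟩ := hΘ b (List.mem_toFinset.2 hb) fun b =>
      word K (forestAt (c.map Prod.snd) b)
    rw [mul_comm, mul_smul, hG, hG, smul_mul_assoc, map_zsmul]

theorem toLie_replacements_tree {v : α → LieMonomial (PlanarTree β)} (hv : ∀ a, (v a).labels.Nodup)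
    (t : PlanarTree α) :
    ((t.replacements v).map fun r => r.1 • r.2.toLie K).sum =
      substitute (fun a => (v a).toLie K) (ofTree K t) := by
  induction t using recOnChildren with
  | h a ts ih =>
    rw [substitute_node hv, graftAll]
    have hts : (ts.map fun t =>
        wordExpansion K (substitute (fun a => (v a).toLie K) (ofTree K t))) =
        (ts.map fun t => (t.replacements v).flatMap fun r => r.2.words.map fun w =>
          (r.1 * w.1, w.2)).map fun rs => (rs.map fun r => r.1 • word K r.2).sum := by
      rw [List.map_map]
      refine List.map_congr_left fun t ht => ?_
      rw [← ih t ht, map_list_sum, List.map_map, Function.comp_apply, List.flatMap_def,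
        List.map_flatten, List.sum_flatten, List.map_map, List.map_map]
      refine congrArg List.sum (List.map_congr_left fun r _ => ?_)
      simp only [Function.comp_apply, map_zsmul, wordExpansion_toLie, List.map_map,
        List.smul_sum, Function.comp_def, mul_smul]
    rw [hts, ← sum_sections _ (hv a) (insertWords_multilinearOn _ (hv a)), PlanarTree.replacements]
    simp only [List.map_map, Function.comp_def, List.flatMap_assoc, List.flatMap_map,
      insertWords_forestAt]

/-- The signed sum of the replacements is the substitution of the Lie monomials `v a` for the
single-vertex trees. -/
theorem toLie_replacements {v : α → LieMonomial (PlanarTree β)} (hv : ∀ a, (v a).labels.Nodup)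
    (m : LieMonomial (PlanarTree α)) :
    ((m.replacements v).map fun r => r.1 • r.2.toLie K).sum =
      substitute (fun a => (v a).toLie K) (m.toLie K) := by
  induction m with
  | of t => exact toLie_replacements_tree hv t
  | bracket m m' h h' =>
    rw [toLie, LieHom.map_lie, ← h, ← h', LieMonomial.replacements]
    generalize m.replacements v = l
    generalize m'.replacements v = l'
    rw [list_sum_lie (K := K), List.flatMap_def, List.map_flatten, List.sum_flatten, List.map_map,
      List.map_map]
    refine congrArg List.sum (List.map_congr_left fun p _ => ?_)
    rw [list_lie_sum (K := K), Function.comp_apply, Function.comp_apply, List.map_map]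
    refine congrArg List.sum (List.map_congr_left fun q _ => ?_)
    rw [Function.comp_apply, smul_lie, lie_smul, mul_smul]
    rfl

omit [DecidableEq β] in
theorem toLie_relabel (f : α → β) (m : LieMonomial (PlanarTree α)) :
    (m.relabel f).toLie K = LieTree.relabel K f (m.toLie K) := by
  induction m with
  | of t => exact (relabel_ofTree f t).symm
  | bracket a b ha hb => rw [LieMonomial.relabel, toLie, toLie, LieHom.map_lie, ha, hb]

omit [DecidableEq β] in
theorem labels_relabel (f : α → β) (m : LieMonomial (PlanarTree α)) :
    (m.relabel f).labels = m.labels.map f := by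
  have ht (t : PlanarTree α) : (t.map f).labels = t.labels.map f := by
    induction t using recOnChildren with
    | h a ts ih =>
      rw [PlanarTree.map, PlanarTree.labels, PlanarTree.labels, List.map_cons, List.map_flatMap,
        List.flatMap_map]
      rw [List.flatMap_def, List.flatMap_def, List.map_congr_left ih]
  induction m with
  | of t => exact ht t
  | bracket a b ha hb => simp only [LieMonomial.relabel, labels, ha, hb, List.map_append]

theorem IsLabelled.nodup {n : ℕ} {m : LieMonomial (PlanarTree (Fin n))} (h : m.IsLabelled) :
    m.labels.Nodup := by
  rw [← Multiset.coe_nodup, h]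
  exact Finset.univ.nodup

end LieMonomial

end

/-! ### The operad of labelled Lie polynomials of trees -/

theorem mainTheorem4 (K : Type*) [Field K] [CharZero K] :
    -- the product `graft` on `Lie(PT)` is the left grafting
    (∀ α : Type, LieTree.IsLeftGrafting K (LieTree.graft K (α := α))) ∧
    -- labelled Lie polynomials of trees are combinations of post-Lie monomials in their vertices
    (∀ (n : ℕ) (z : LabelledLieTree K n), ∃ e : PostLiePoly K (Fin n),
      (∀ m ∈ e.support, m.labels = Finset.univ.val) ∧ LieTree.IsExpression K e z) ∧
    ∃ S : SymOperad K (fun n => LabelledLieTree K n),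
      -- the symmetric groups permute the labels
      (∀ (n : ℕ) (σ : Equiv.Perm (Fin n)) (z : LabelledLieTree K n),
        (S.act n σ z : LieTree K (Fin n)) = LieTree.relabel K σ z) ∧
      -- the identity is the single-vertex tree
      (S.one : LieTree K (Fin 1)) = LieTree.ofTree K (PlanarTree.bullet 0) ∧
      -- the composition substitutes the `x i` for the vertices in any expression of `z`
      (∀ (n : ℕ) (k : Fin n → ℕ) (x : ∀ i, LabelledLieTree K (k i)) (z : LabelledLieTree K n)
        (e : PostLiePoly K (Fin n)), LieTree.IsExpression K e z →
        (S.comp k x z : LieTree K (Fin (∑ i, k i))) =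
          LieTree.evalPoly K
            (fun i => LieTree.relabel K (fun l => finSigmaFinEquiv ⟨i, l⟩) (x i)) e) ∧
      -- the combinatorial description of the composition of Lie monomials of trees
      (∀ (n : ℕ) (k : Fin n → ℕ) (x : ∀ i, LabelledLieTree K (k i)) (z : LabelledLieTree K n)
        (a : ∀ i, LieMonomial (PlanarTree (Fin (k i)))) (m : LieMonomial (PlanarTree (Fin n))),
        (∀ i, (a i).IsLabelled) → (∀ i, (a i).toLie K = x i) → m.IsLabelled → m.toLie K = z →
        (S.comp k x z : LieTree K (Fin (∑ i, k i))) =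
          ((m.replacements
            (fun i => (a i).relabel fun l => finSigmaFinEquiv ⟨i, l⟩)).map
              fun r => r.1 • r.2.toLie K).sum) ∧
      -- it is the post-Lie operad, with its two operations acting as the bracket and the grafting
      ∃ φ : SymOperad.Iso (postLieOperad K) S,
        ∀ (n : ℕ) (y : PostLie K n) (e : PostLiePoly K (Fin n)), FreePostLie.mk K e = y →
          LieTree.IsExpression K e (φ.equiv n y) := by
  -- The transported composition is the substitution for the single-vertex trees.
  have hcomp (n : ℕ) (k : Fin n → ℕ) (x : ∀ i, LabelledLieTree K (k i)) (z : LabelledLieTree K n) :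
      (((postLieOperad K).transport (labelledEquiv K)).comp k x z : LieTree K (Fin (∑ i, k i))) =
        LieTree.substitute (fun i => LieTree.relabel K (fun l => finSigmaFinEquiv ⟨i, l⟩) (x i))
          (z : LieTree K (Fin n)) := by
    have h : ((postLieOperad K).transport (labelledEquiv K)).comp k x z =
      labelledEquiv K _ (PostLie.comp k (fun i => (labelledEquiv K _).symm (x i))
        ((labelledEquiv K n).symm z)) := rfl
    rw [h, coe_labelledEquiv, PostLie.coe_comp, LieTree.freePostLieEquiv_apply,
      LieTree.eval_subst, coe_labelledEquiv_symm, LieTree.freePostLieEquiv_symm_apply,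
      LieTree.substitute_apply]
    congr 2
    funext i
    rw [← LieTree.freePostLieEquiv_apply, LieTree.freePostLieEquiv_rename, coe_labelledEquiv_symm,
      LinearEquiv.apply_symm_apply]
  refine ⟨fun α => LieTree.graft_isLeftGrafting, fun n z => ?_,
    (postLieOperad K).transport (labelledEquiv K), fun n σ z => ?_, ?_, fun n k x z e he => ?_,
    fun n k x z a m ha hax _ hmz => ?_,
    (postLieOperad K).transportIso (labelledEquiv K), fun n y e he => ?_⟩
  · obtain ⟨e, hs, he⟩ :=
      FreePostLie.exists_mk_eq_of_mem_weightSpace ((labelledEquiv K n).symm z).2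
    refine ⟨e, hs, ?_⟩
    have h := coe_labelledEquiv ((labelledEquiv K n).symm z)
    rw [LinearEquiv.apply_symm_apply, ← he] at h
    exact h.symm
  · have h : ((postLieOperad K).transport (labelledEquiv K)).act n σ z =
      labelledEquiv K n (PostLie.act n σ ((labelledEquiv K n).symm z)) := rfl
    rw [h, coe_labelledEquiv, PostLie.coe_act, LieTree.freePostLieEquiv_rename,
      coe_labelledEquiv_symm, LinearEquiv.apply_symm_apply]
  · exact LieTree.eval_gen _ 0
  · have h : (LieTree.freePostLieEquiv K (Fin n)) (FreePostLie.mk K e) = z := he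
    rw [hcomp, ← h, LieTree.substitute_apply, ← LieTree.freePostLieEquiv_symm_apply,
      LinearEquiv.symm_apply_apply, LieTree.eval_mk]
  · rw [hcomp, LieMonomial.toLie_replacements fun i => ?_, hmz]
    · simp only [LieMonomial.toLie_relabel, hax]
    · rw [LieMonomial.labels_relabel]
      refine (ha i).nodup.map fun l l' h => ?_
      simpa using finSigmaFinEquiv.injective h
  · rw [LieTree.IsExpression, ← LieTree.eval_mk, he]
    rfl
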